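/- Let $\mathbb N^\times$ be the multiplicative monoid of positive integers, viewed as a category with one object $*$, and let $\widehat{\mathbb N^\times}$ be the topos of presheaves of sets on it. Let $\mathcal O=\mathbb Z_{\max}=(\mathbb Z\cup\{-\infty\},\max,+)$ be the semiring in this topos on which $k\in\mathbb N^\times$ acts by $n\mapsto kn$ (and $-\infty\mapsto-\infty$). Let $\mathbb R_+^{\max}$ be the semifield $[0,\infty)$ with addition $\max$ and the usual product, with its automorphisms $\mathrm{Fr}_\lambda(x)=x^\lambda$, $\lambda>0$. A point of the arithmetic site $(\widehat{\mathbb N^\times},\mathcal O)$ over $\mathbb R_+^{\max}$ is a pair $(p,f)$, where $p$ is a point of the topos (a geometric morphism from the topos of sets) and $f:\mathcal O_p=p^*\mathcal O\to\mathbb R_+^{\max}$ is a morphism of semirings; $(p,f)$ and $(q,g)$ are equivalent if there is an isomorphism $\phi:p\simeq q$ with $g\circ\phi^\#=f$, where $\phi^\#:\mathcal O_p\to\mathcal O_q$ is the induced isomorphism of stalks. $\mathrm{Fr}_\lambda$ acts on classes of points by $(p,f)\mapsto(p,\mathrm{Fr}_\lambda\circ f)$. Let $\mathbb A_{\mathbb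 Q}=\mathbb R\times\mathbb A^f$ be the adeles of $\mathbb Q$, $\hat{\mathbb Z}=\prod_p\mathbb Z_p\subset\mathbb A^f$, and for $a\in\mathbb A^f$ let $H_a=\{q\in\mathbb Q\mid aq\in\hat{\mathbb Z}\}$. The group $\hat{\mathbb Z}^\times$ acts on $\mathbb A_{\mathbb Q}$ through the finite component and $\mathbb Q^\times$ acts diagonally. Theorem. There is a bijection $\Theta$ from the set of equivalence classes of points of $(\widehat{\mathbb N^\times},\mathcal O)$ over $\mathbb R_+^{\max}$ onto $\hat{\mathbb Z}^\times\backslash\mathbb A_{\mathbb Q}/\mathbb Q^\times$ such that: (1) $\Theta$ is the canonical one: with $y$ the representable presheaf, $X=p^*(y)$ with its action of $\mathbb N^\times$, and $\beta:X\to\mathcal O_p$ the map induced by the section $1\in\mathbb Z$, one has $\Theta(p,f)=[(r,a)]$ if and only if there is an $\mathbb N^\times$-equivariant bijection $j:X\to\{h\in H_a\mid h>0\}$ with $f(\beta(x))=e^{|r|j(x)}$ for all $x\in X$. (2) $\Theta(p,\mathrm{Fr}_\lambda\circ f)=\lambda\cdot\Theta(p,f)$ for all $\lambda>0$, where $\lambda$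 acts through the class of the idele $(\lambda,1)$ in the idele class group $\mathbb A_{\mathbb Q}^\times/\mathbb Q^\times$. Conversely every idele class is the class of $(\lambda,u)$ for some $u\in\hat{\mathbb Z}^\times$ and $\lambda>0$, and acts as $\mathrm{Fr}_\lambda$. (3) $(p,f)$ is degenerate, i.e. $f$ has range in $\{0,1\}$, if and only if $\Theta(p,f)$ is the class of some $(0,a)$ with $a\in\mathbb A^f$, and if and only if its class is fixed by all $\mathrm{Fr}_\lambda$. (4) If $\Theta(p,f)=[(r,a)]$ then $\{\log u\mid u\in f(\mathcal O_p),\ u\neq0\}=|r|H_a\subset\mathbb R$. -/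

import Mathlib

open CategoryTheory Opposite
open scoped NNReal

noncomputable section

namespace ArithSite

/-! ### The semifields of characteristic one -/

/-- The tropical integers: `ℤ ∪ {-∞}` with addition `max` and multiplication `+`. -/
def ZMax : Type := WithBot ℤ

namespace ZMax

/-- The element of `ZMax` given by an element of `ℤ ∪ {-∞}`. -/
def mk (x : WithBot ℤ) : ZMax := x

/-- The underlying element of `ℤ ∪ {-∞}`. -/
def val (x : ZMax) : WithBot ℤ := x

instance : Add ZMax := ⟨fun x y => mk (max x.val y.val)⟩

instance : Mul ZMax := ⟨fun x y => mk (x.val + y.val)⟩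

instance : Zero ZMax := ⟨mk ⊥⟩

instance : One ZMax := ⟨mk 0⟩

instance : CommSemiring ZMax where
  nsmul := nsmulRec
  add_assoc x y z := max_assoc x.val y.val z.val
  zero_add x := max_eq_right (bot_le (a := x.val))
  add_zero x := max_eq_left (bot_le (a := x.val))
  add_comm x y := max_comm x.val y.val
  mul_assoc x y z := add_assoc x.val y.val z.val
  one_mul x := zero_add x.val
  mul_one x := add_zero x.val
  mul_comm x y := add_comm x.val y.val
  zero_mul x := WithBot.bot_add x.val
  mul_zero x := WithBot.add_bot x.val
  left_distrib x y z := (max_add_add_left x.val y.val z.val).symm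
  right_distrib x y z := (max_add_add_right x.val y.val z.val).symm

/-- The Frobenius endomorphism `Fr_k : n ↦ k n`, `-∞ ↦ -∞`. -/
def frob (k : ℕ+) : ZMax →+* ZMax where
  toFun x := mk (x.val.map fun n : ℤ => (k : ℤ) * n)
  map_one' := congrArg (fun n : ℤ => mk (n : WithBot ℤ)) (mul_zero (k : ℤ))
  map_zero' := rfl
  map_mul' x y := by
    change WithBot.map (fun n : ℤ => (k : ℤ) * n) (x.val + y.val) =
      WithBot.map (fun n : ℤ => (k : ℤ) * n) x.val + WithBot.map (fun n : ℤ => (k : ℤ) * n) y.val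
    induction x.val using WithBot.recBotCoe with
    | bot => simp
    | coe a =>
      induction y.val using WithBot.recBotCoe with
      | bot => simp
      | coe b => exact congrArg _ (mul_add (k : ℤ) a b)
  map_add' x y := by
    have h : Monotone fun n : ℤ => (k : ℤ) * n := fun a b hab =>
      mul_le_mul_of_nonneg_left hab (by positivity)
    exact (h.withBot_map).map_max

theorem frob_mul (k l : ℕ+) (x : ZMax) : frob (k * l) x = frob l (frob k x) := by
  change WithBot.map (fun n : ℤ => ((k * l : ℕ+) : ℤ) * n) x.val =
    WithBot.map (fun n : ℤ => (l : ℤ) * n) (WithBot.map (fun n : ℤ => (k : ℤ) * n) x.val)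
  rw [WithBot.map_map]
  congr 1
  funext n
  simp only [PNat.mul_coe, Nat.cast_mul, Function.comp]
  ring

end ZMax

/-- The multiplicative tropical semifield: `[0,∞)` with addition `max` and the usual product. -/
def RMax : Type := ℝ≥0

namespace RMax

/-- The element of `RMax` given by a nonnegative real number. -/
def mk (x : ℝ≥0) : RMax := x

/-- The underlying nonnegative real number. -/
def val (x : RMax) : ℝ≥0 := x

instance : Add RMax := ⟨fun x y => mk (max x.val y.val)⟩

instance : Mul RMax := ⟨fun x y => mk (x.val * y.val)⟩

instance : Zero RMax := ⟨mk 0⟩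

instance : One RMax := ⟨mk 1⟩

instance : CommSemiring RMax where
  nsmul := nsmulRec
  add_assoc x y z := max_assoc x.val y.val z.val
  zero_add x := max_eq_right (zero_le : 0 ≤ x.val)
  add_zero x := max_eq_left (zero_le : 0 ≤ x.val)
  add_comm x y := max_comm x.val y.val
  mul_assoc x y z := mul_assoc x.val y.val z.val
  one_mul x := one_mul x.val
  mul_one x := mul_one x.val
  mul_comm x y := mul_comm x.val y.val
  zero_mul x := zero_mul x.val
  mul_zero x := mul_zero x.val
  left_distrib x y z := mul_max_of_nonneg y.val z.val (zero_le : 0 ≤ x.val)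
  right_distrib x y z := max_mul_of_nonneg x.val y.val (zero_le : 0 ≤ z.val)

/-- The Frobenius automorphism `Fr_t : x ↦ x ^ t` of `RMax`, for `t > 0`. -/
def frob (t : {t : ℝ // 0 < t}) : RMax ≃+* RMax where
  toFun x := mk (x.val ^ (t : ℝ))
  invFun x := mk (x.val ^ (t : ℝ)⁻¹)
  left_inv x := NNReal.rpow_rpow_inv t.2.ne' x.val
  right_inv x := NNReal.rpow_inv_rpow t.2.ne' x.val
  map_mul' _ _ := NNReal.mul_rpow
  map_add' _ _ := (NNReal.monotone_rpow_of_nonneg t.2.le).map_max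

end RMax

/-! ### Geometric morphisms, points and stalks -/

universe u

/-- A geometric morphism `E → F`: an adjoint pair `f^* ⊣ f_*` with `f^*` left exact. -/
structure GeomMorphism (E : Type*) [Category* E] (F : Type*) [Category* F] where
  /-- the inverse image functor `f^*` -/
  inverseImage : F ⥤ E
  /-- the direct image functor `f_*` -/
  directImage : E ⥤ F
  /-- the adjunction `f^* ⊣ f_*` -/
  adj : inverseImage ⊣ directImage
  leftExact : Limits.PreservesFiniteLimits inverseImage

attribute [instance] GeomMorphism.leftExact

/-- A point of the presheaf topos on a small category `C`: a geometric morphism from the topos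
of sets to the topos of presheaves of sets on `C`. -/
abbrev ToposPoint (C : Type u) [SmallCategory C] := GeomMorphism (Type u) (Cᵒᵖ ⥤ Type u)

namespace ToposPoint

open FunctorToTypes

variable {C : Type u} [SmallCategory C] (p : ToposPoint C)

/-- The comparison map `p^*(F × G) → p^* F × p^* G`. -/
def prodComparison (F G : Cᵒᵖ ⥤ Type u) (t : p.inverseImage.obj (FunctorToTypes.prod F G)) :
    p.inverseImage.obj F × p.inverseImage.obj G :=
  (p.inverseImage.map prod.fst t, p.inverseImage.map prod.snd t)

theorem prodComparison_bijective (F G : Cᵒᵖ ⥤ Type u) :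
    Function.Bijective (p.prodComparison F G) := by
  have hl := Limits.mapIsLimitOfPreservesOfIsLimit p.inverseImage _ _
    (FunctorToTypes.binaryProductLimit F G)
  let e := hl.conePointUniqueUpToIso (Limits.Types.binaryProductLimit _ _)
  have he : ∀ t, e.hom t = p.prodComparison F G t := fun t => by
    have h1 := ConcreteCategory.congr_hom
      (hl.conePointUniqueUpToIso_hom_comp (Limits.Types.binaryProductLimit _ _)
        ⟨Limits.WalkingPair.left⟩) t
    have h2 := ConcreteCategory.congr_hom
      (hl.conePointUniqueUpToIso_hom_comp (Limits.Types.binaryProductLimit _ _)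
        ⟨Limits.WalkingPair.right⟩) t
    exact Prod.ext h1 h2
  have : Function.Bijective e.hom := (isIso_iff_bijective e.hom).1 inferInstance
  rwa [show (e.hom : _ → _) = p.prodComparison F G from funext he] at this

/-- The canonical bijection `p^* F × p^* G ≃ p^*(F × G)`. -/
def prodEquiv (F G : Cᵒᵖ ⥤ Type u) :
    p.inverseImage.obj F × p.inverseImage.obj G ≃
      p.inverseImage.obj (FunctorToTypes.prod F G) :=
  (Equiv.ofBijective _ (p.prodComparison_bijective F G)).symm

/-- The terminal presheaf. -/
def terminalPresheaf (C : Type u) [SmallCategory C] : Cᵒᵖ ⥤ Type u :=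
  (Functor.const _).obj PUnit

/-- The unique map to the terminal presheaf. -/
def toTerminal (F : Cᵒᵖ ⥤ Type u) : F ⟶ terminalPresheaf C where
  app _ := ↾fun _ => PUnit.unit

/-- The terminal presheaf is terminal. -/
def terminalPresheafIsTerminal : Limits.IsTerminal (terminalPresheaf C) :=
  Limits.IsTerminal.ofUniqueHom toTerminal fun _ _ => rfl

/-- The inverse image of the terminal presheaf is a one-point set. -/
instance uniqueTerminal : Unique (p.inverseImage.obj (terminalPresheaf C)) :=
  Limits.Types.isTerminalEquivUnique _
    (Limits.IsTerminal.isTerminalObj p.inverseImage _ terminalPresheafIsTerminal)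

/-- The binary operation on `p^* F` induced by a binary operation `F × F → F`. -/
def stalkOp {F : Cᵒᵖ ⥤ Type u} (m : FunctorToTypes.prod F F ⟶ F) (a b : p.inverseImage.obj F) :
    p.inverseImage.obj F :=
  p.inverseImage.map m (p.prodEquiv F F (a, b))

/-- The element of `p^* F` induced by a global section `1 → F`. -/
def stalkConst {F : Cᵒᵖ ⥤ Type u} (z : terminalPresheaf C ⟶ F) : p.inverseImage.obj F :=
  p.inverseImage.map z default

theorem stalkOp_map {F G : Cᵒᵖ ⥤ Type u} (m : FunctorToTypes.prod F F ⟶ F) (a b : G ⟶ F)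
    (t : p.inverseImage.obj G) :
    p.stalkOp m (p.inverseImage.map a t) (p.inverseImage.map b t) =
      p.inverseImage.map (prod.lift a b ≫ m) t := by
  have h : p.prodEquiv F F (p.inverseImage.map a t, p.inverseImage.map b t) =
      p.inverseImage.map (prod.lift a b) t := by
    apply (p.prodComparison_bijective F F).1
    refine ((Equiv.ofBijective _ (p.prodComparison_bijective F F)).apply_symm_apply _).trans ?_
    refine Prod.ext ?_ ?_
    · exact ConcreteCategory.congr_hom (p.inverseImage.map_comp (prod.lift a b) prod.fst) t
    · exact ConcreteCategory.congr_hom (p.inverseImage.map_comp (prod.lift a b) prod.snd) t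
  rw [stalkOp, h]
  exact (ConcreteCategory.congr_hom (p.inverseImage.map_comp (prod.lift a b) m) t).symm

theorem stalkConst_map {F G : Cᵒᵖ ⥤ Type u} (z : terminalPresheaf C ⟶ F)
    (t : p.inverseImage.obj G) :
    p.stalkConst z = p.inverseImage.map (toTerminal G ≫ z) t := by
  refine Eq.trans ?_ (ConcreteCategory.congr_hom (p.inverseImage.map_comp (toTerminal G) z) t).symm
  exact congrArg (p.inverseImage.map z)
    (Subsingleton.elim (α := p.inverseImage.obj (terminalPresheaf C)) _ _)

theorem exists_two {F : Cᵒᵖ ⥤ Type u} (a b : p.inverseImage.obj F) :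
    ∃ t : p.inverseImage.obj (FunctorToTypes.prod F F),
      p.inverseImage.map prod.fst t = a ∧ p.inverseImage.map prod.snd t = b := by
  obtain ⟨t, ht⟩ := (p.prodComparison_bijective F F).2 (a, b)
  exact ⟨t, congrArg Prod.fst ht, congrArg Prod.snd ht⟩

theorem exists_three {F : Cᵒᵖ ⥤ Type u} (a b c : p.inverseImage.obj F) :
    ∃ t : p.inverseImage.obj (FunctorToTypes.prod F (FunctorToTypes.prod F F)),
      p.inverseImage.map prod.fst t = a ∧ p.inverseImage.map (prod.snd ≫ prod.fst) t = b ∧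
        p.inverseImage.map (prod.snd ≫ prod.snd) t = c := by
  obtain ⟨s, rfl, rfl⟩ := p.exists_two b c
  obtain ⟨t, ht⟩ := (p.prodComparison_bijective F (FunctorToTypes.prod F F)).2 (a, s)
  refine ⟨t, congrArg Prod.fst ht, ?_, ?_⟩ <;>
    rw [Functor.map_comp, ← show p.inverseImage.map prod.snd t = s from congrArg Prod.snd ht] <;>
    rfl

end ToposPoint

section Stalk

variable {C : Type u} [SmallCategory C]

/-- The underlying presheaf of sets of a presheaf of semirings. -/
abbrev underlying (O : Cᵒᵖ ⥤ CommSemiRingCat.{u}) : Cᵒᵖ ⥤ Type u :=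
  O ⋙ forget CommSemiRingCat

variable (O : Cᵒᵖ ⥤ CommSemiRingCat.{u})

/-- The addition `O × O → O`. -/
def addMap : FunctorToTypes.prod (underlying O) (underlying O) ⟶ underlying O where
  app U := ↾fun a => ((a.1 : O.obj U) + (a.2 : O.obj U) : O.obj U)
  naturality _ _ f := by
    ext a
    exact (map_add (O.map f).hom _ _).symm

/-- The multiplication `O × O → O`. -/
def mulMap : FunctorToTypes.prod (underlying O) (underlying O) ⟶ underlying O where
  app U := ↾fun a => ((a.1 : O.obj U) * (a.2 : O.obj U) : O.obj U)
  naturality _ _ f := by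
    ext a
    exact (map_mul (O.map f).hom _ _).symm

/-- The zero section `1 → O`. -/
def zeroMap : ToposPoint.terminalPresheaf C ⟶ underlying O where
  app U := ↾fun _ => (0 : O.obj U)
  naturality _ _ f := by
    ext a
    exact (map_zero (O.map f).hom).symm

/-- The unit section `1 → O`. -/
def oneMap : ToposPoint.terminalPresheaf C ⟶ underlying O where
  app U := ↾fun _ => (1 : O.obj U)
  naturality _ _ f := by
    ext a
    exact (map_one (O.map f).hom).symm

/-- The stalk `O_p = p^* O`, a semiring because `p^*` commutes with finite products. -/
def Stalk (O : Cᵒᵖ ⥤ CommSemiRingCat.{u}) (p : ToposPoint C) : Type u :=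
  p.inverseImage.obj (underlying O)

namespace Stalk

variable {O} {p : ToposPoint C}

instance : Add (Stalk O p) := ⟨p.stalkOp (addMap O)⟩

instance : Mul (Stalk O p) := ⟨p.stalkOp (mulMap O)⟩

instance : Zero (Stalk O p) := ⟨p.stalkConst (zeroMap O)⟩

instance : One (Stalk O p) := ⟨p.stalkConst (oneMap O)⟩

open ToposPoint

/-- The value at `t ∈ p^* G` of the map `p^* G → O_p` induced by `a : G → O`. -/
def germ {G : Cᵒᵖ ⥤ Type u} (a : G ⟶ underlying O) (t : p.inverseImage.obj G) : Stalk O p :=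
  p.inverseImage.map a t

theorem germ_add {G : Cᵒᵖ ⥤ Type u} (a b : G ⟶ underlying O) (t : p.inverseImage.obj G) :
    germ a t + germ b t = germ (FunctorToTypes.prod.lift a b ≫ addMap O) t :=
  p.stalkOp_map _ a b t

theorem germ_mul {G : Cᵒᵖ ⥤ Type u} (a b : G ⟶ underlying O) (t : p.inverseImage.obj G) :
    germ a t * germ b t = germ (FunctorToTypes.prod.lift a b ≫ mulMap O) t :=
  p.stalkOp_map _ a b t

theorem zero_eq {G : Cᵒᵖ ⥤ Type u} (t : p.inverseImage.obj G) :
    (0 : Stalk O p) = germ (toTerminal G ≫ zeroMap O) t := p.stalkConst_map _ t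

theorem one_eq {G : Cᵒᵖ ⥤ Type u} (t : p.inverseImage.obj G) :
    (1 : Stalk O p) = germ (toTerminal G ≫ oneMap O) t := p.stalkConst_map _ t

theorem exists_one (a : Stalk O p) :
    ∃ t : p.inverseImage.obj (underlying O), germ (𝟙 (underlying O)) t = a :=
  ⟨a, ConcreteCategory.congr_hom (p.inverseImage.map_id (underlying O)) a⟩

theorem exists_two (a b : Stalk O p) :
    ∃ t : p.inverseImage.obj (FunctorToTypes.prod (underlying O) (underlying O)),
      germ FunctorToTypes.prod.fst t = a ∧ germ FunctorToTypes.prod.snd t = b :=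
  ToposPoint.exists_two p a b

theorem exists_three (a b c : Stalk O p) :
    ∃ t : p.inverseImage.obj (FunctorToTypes.prod (underlying O)
        (FunctorToTypes.prod (underlying O) (underlying O))),
      germ FunctorToTypes.prod.fst t = a ∧
      germ (FunctorToTypes.prod.snd ≫ FunctorToTypes.prod.fst) t = b ∧
      germ (FunctorToTypes.prod.snd ≫ FunctorToTypes.prod.snd) t = c :=
  ToposPoint.exists_three p a b c

theorem germ_congr {G : Cᵒᵖ ⥤ Type u} {a b : G ⟶ underlying O} (t : p.inverseImage.obj G)
    (h : ∀ (U : Cᵒᵖ) (x : G.obj U), a.app U x = b.app U x) : germ a t = germ b t := by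
  have : a = b := by
    ext U x
    exact h U x
  rw [this]

instance : CommSemiring (Stalk O p) where
  nsmul := nsmulRec
  add_assoc a b c := by
    obtain ⟨t, rfl, rfl, rfl⟩ := exists_three a b c
    simp only [germ_add]
    exact germ_congr t fun U _ => add_assoc (G := O.obj U) _ _ _
  zero_add a := by
    obtain ⟨t, rfl⟩ := exists_one a
    rw [zero_eq t]
    simp only [germ_add]
    exact germ_congr t fun U _ => zero_add (M := O.obj U) _
  add_zero a := by
    obtain ⟨t, rfl⟩ := exists_one a
    rw [zero_eq t]
    simp only [germ_add]
    exact germ_congr t fun U _ => add_zero (M := O.obj U) _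
  add_comm a b := by
    obtain ⟨t, rfl, rfl⟩ := exists_two a b
    simp only [germ_add]
    exact germ_congr t fun U _ => add_comm (G := O.obj U) _ _
  mul_assoc a b c := by
    obtain ⟨t, rfl, rfl, rfl⟩ := exists_three a b c
    simp only [germ_mul]
    exact germ_congr t fun U _ => mul_assoc (G := O.obj U) _ _ _
  one_mul a := by
    obtain ⟨t, rfl⟩ := exists_one a
    rw [one_eq t]
    simp only [germ_mul]
    exact germ_congr t fun U _ => one_mul (M := O.obj U) _
  mul_one a := by
    obtain ⟨t, rfl⟩ := exists_one a
    rw [one_eq t]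
    simp only [germ_mul]
    exact germ_congr t fun U _ => mul_one (M := O.obj U) _
  mul_comm a b := by
    obtain ⟨t, rfl, rfl⟩ := exists_two a b
    simp only [germ_mul]
    exact germ_congr t fun U _ => mul_comm (G := O.obj U) _ _
  zero_mul a := by
    obtain ⟨t, rfl⟩ := exists_one a
    rw [zero_eq t]
    simp only [germ_mul]
    exact germ_congr t fun U _ => zero_mul (M₀ := O.obj U) _
  mul_zero a := by
    obtain ⟨t, rfl⟩ := exists_one a
    rw [zero_eq t]
    simp only [germ_mul]
    exact germ_congr t fun U _ => mul_zero (M₀ := O.obj U) _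
  left_distrib a b c := by
    obtain ⟨t, rfl, rfl, rfl⟩ := exists_three a b c
    simp only [germ_mul, germ_add]
    exact germ_congr t fun U _ => mul_add (R := O.obj U) _ _ _
  right_distrib a b c := by
    obtain ⟨t, rfl, rfl, rfl⟩ := exists_three a b c
    simp only [germ_mul, germ_add]
    exact germ_congr t fun U _ => add_mul (R := O.obj U) _ _ _

end Stalk

end Stalk

/-! ### Points over the tropical semifield -/

section RMaxPoints

variable {C : Type u} [SmallCategory C]

/-- A point over `RMax` of the presheaf topos on `C` with structure sheaf `O`: a point `p` of the
topos together with a morphism of semirings from the stalk `O_p` to `RMax`. -/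
structure RMaxPoint (O : Cᵒᵖ ⥤ CommSemiRingCat.{u}) where
  /-- the point of the topos -/
  point : ToposPoint C
  /-- the morphism of semirings on the stalk -/
  hom : Stalk O point →+* RMax

variable (O : Cᵒᵖ ⥤ CommSemiRingCat.{u})

/-- Two points over `RMax` are equivalent when there is an isomorphism of the underlying points
of the topos which is compatible with the morphisms from the stalks to `RMax`. -/
instance RMaxPoint.setoid : Setoid (RMaxPoint O) where
  r P Q := ∃ φ : P.point.inverseImage ≅ Q.point.inverseImage,
    ∀ s : P.point.inverseImage.obj (underlying O), Q.hom (φ.hom.app (underlying O) s) = P.hom s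
  iseqv :=
    { refl := fun P => ⟨Iso.refl _, fun _ => rfl⟩
      symm := by
        rintro P Q ⟨φ, h⟩
        refine ⟨φ.symm, fun s => (h _).symm.trans (congrArg Q.hom ?_)⟩
        exact ConcreteCategory.congr_hom (φ.inv_hom_id_app (underlying O)) s
      trans := by
        rintro P Q R ⟨φ, h⟩ ⟨ψ, k⟩
        exact ⟨φ ≪≫ ψ, fun s => (k _).trans (h s)⟩ }

/-- The set of points over `RMax`, up to equivalence. -/
abbrev RMaxPoints := Quotient (RMaxPoint.setoid O)

variable {O}

/-- The Frobenius `Fr_t` acts on points by composition: `(p, f) ↦ (p, Fr_t ∘ f)`. -/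
def RMaxPoint.frob (t : {t : ℝ // 0 < t}) (P : RMaxPoint O) : RMaxPoint O where
  point := P.point
  hom := (RMax.frob t : RMax →+* RMax).comp P.hom

/-- The action of the Frobenius `Fr_t` on equivalence classes of points. -/
def RMaxPoints.frob (t : {t : ℝ // 0 < t}) : RMaxPoints O → RMaxPoints O :=
  Quotient.map (RMaxPoint.frob t) fun _ _ ⟨φ, h⟩ => ⟨φ, fun s => congrArg (RMax.frob t) (h s)⟩

/-- A point is degenerate when the range of the map on the stalk is contained in `{0, 1}`. -/
def RMaxPoint.IsDegenerate (P : RMaxPoint O) : Prop :=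
  ∀ s, P.hom s = 0 ∨ P.hom s = 1

/-- The set `{log u | u ∈ f(O_p), u ≠ 0}` attached to a point `(p, f)`. -/
def RMaxPoint.logRange (P : RMaxPoint O) : Set ℝ :=
  {y | ∃ s, P.hom s ≠ 0 ∧ y = Real.log ((P.hom s).val : ℝ)}

end RMaxPoints

/-! ### The arithmetic site -/

/-- The structure sheaf of the arithmetic site: the semiring `ZMax` in the topos of presheaves on
the one-object category `ℕ+`, where `k` acts by the Frobenius endomorphism `Fr_k`. -/
def structureSheaf : (SingleObj ℕ+)ᵒᵖ ⥤ CommSemiRingCat.{0} where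
  obj _ := CommSemiRingCat.of ZMax
  map f := CommSemiRingCat.ofHom (ZMax.frob f.unop)
  map_id _ := by
    ext x
    change WithBot.map (fun n : ℤ => (((1 : ℕ+) : ℕ) : ℤ) * n) (ZMax.val x) = ZMax.val x
    cases ZMax.val x <;> simp
  map_comp f g := by
    ext x
    exact ZMax.frob_mul f.unop g.unop x

/-- The representable object of the topos. -/
abbrev rep : (SingleObj ℕ+)ᵒᵖ ⥤ Type := yoneda.obj (SingleObj.star ℕ+)

/-- The set `X = F(∗)` of the flat functor `F : ℕ+ → Sets` of the point `p`. -/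
abbrev flatSet (p : ToposPoint (SingleObj ℕ+)) : Type := p.inverseImage.obj rep

/-- The action `F(k) : X → X`. -/
def flatAct (p : ToposPoint (SingleObj ℕ+)) (k : ℕ+) (x : flatSet p) : flatSet p :=
  p.inverseImage.map (yoneda.map (SingleObj.toEnd ℕ+ k)) x

/-- The map `rep → ZMax` given by the section `1 ∈ ℤ`, by Yoneda. -/
def unitSection : rep ⟶ underlying structureSheaf :=
  yonedaEquiv.symm (ZMax.mk ((1 : ℤ) : WithBot ℤ) : ZMax)

/-- The canonical map from `X` to the stalk of the structure sheaf. (When the point is the one of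
the rank one ordered group `H`, it is the inclusion `H_{>0} ⊂ H ∪ {-∞}`.) -/
def toStalk (p : ToposPoint (SingleObj ℕ+)) (x : flatSet p) : Stalk structureSheaf p :=
  Stalk.germ unitSection x

/-! ### Adeles of `ℚ` -/

/-- The ring of adeles of `ℚ`. -/
abbrev Adele := NumberField.AdeleRing ℤ ℚ

/-- The ring of finite adeles of `ℚ`. -/
abbrev FinAdele := IsDedekindDomain.FiniteAdeleRing ℤ ℚ

/-- Every infinite place of `ℚ` is real. -/
theorem isReal_place (v : NumberField.InfinitePlace ℚ) : v.IsReal :=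
  NumberField.IsTotallyReal.isReal v

/-- The real numbers as the Archimedean part of the adeles. -/
def realEquiv : NumberField.InfiniteAdeleRing ℚ ≃+* ℝ :=
  (RingEquiv.piUnique fun v : NumberField.InfinitePlace ℚ => v.Completion).trans
    (NumberField.InfinitePlace.Completion.ringEquivRealOfIsReal (isReal_place default))

namespace Adele

/-- The Archimedean component of an adele, as a real number. -/
def real (α : Adele) : ℝ := realEquiv α.1

/-- The finite component of an adele. -/
def fin (α : Adele) : FinAdele := α.2

/-- The adele with given Archimedean and finite components. -/
def mk (r : ℝ) (a : FinAdele) : Adele := (realEquiv.symm r, a)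

/-- `mk` is multiplicative. -/
def mkHom : ℝ × FinAdele →* Adele where
  toFun x := mk x.1 x.2
  map_one' := Prod.ext (map_one realEquiv.symm) rfl
  map_mul' x y := Prod.ext (map_mul realEquiv.symm x.1 y.1) rfl

end Adele

/-- The subring `Ẑ = ∏ ℤ_p` of the ring of finite adeles. -/
def zHat : Subring FinAdele where
  carrier := {a | ∀ v, a v ∈ v.adicCompletionIntegers ℚ}
  mul_mem' ha hb v := mul_mem (ha v) (hb v)
  one_mem' v := one_mem (v.adicCompletionIntegers ℚ)
  add_mem' ha hb v := add_mem (ha v) (hb v)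
  zero_mem' v := zero_mem (v.adicCompletionIntegers ℚ)
  neg_mem' ha v := neg_mem (ha v)

/-- The embedding `u ↦ (1, u)` of `Ẑˣ` in the group of ideles. -/
def zHatUnits : zHatˣ →* Adeleˣ :=
  Units.map (Adele.mkHom.comp ((MonoidHom.inr ℝ FinAdele).comp zHat.subtype.toMonoidHom))

/-- The embedding `t ↦ (t, 1)` of the multiplicative group of positive reals in the group of
ideles. -/
def posReal (t : {t : ℝ // 0 < t}) : Adeleˣ :=
  Units.map (Adele.mkHom.comp (MonoidHom.inl ℝ FinAdele)) (Units.mk0 (t : ℝ) t.2.ne')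

/-- The diagonal embedding of `ℚˣ` in the group of ideles. -/
def principal : ℚˣ →* Adeleˣ := Units.map (algebraMap ℚ Adele).toMonoidHom

/-- The idele class group of `ℚ`. -/
abbrev IdeleClass := Adeleˣ ⧸ principal.range

/-- The orbit equivalence relation of the action of `Ẑˣ × ℚˣ` on the adeles. -/
instance adeleSetoid : Setoid Adele where
  r α β := ∃ (u : zHatˣ) (q : ℚˣ), (zHatUnits u * principal q : Adeleˣ) • α = β
  iseqv :=
    { refl := fun α => ⟨1, 1, by simp⟩
      symm := by
        rintro α _ ⟨u, q, rfl⟩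
        exact ⟨u⁻¹, q⁻¹, by rw [map_inv, map_inv, ← mul_inv, inv_smul_smul]⟩
      trans := by
        rintro α _ _ ⟨u, q, rfl⟩ ⟨u', q', rfl⟩
        exact ⟨u' * u, q' * q, by rw [map_mul, map_mul, mul_mul_mul_comm, mul_smul]⟩ }

/-- The quotient `Ẑˣ \ 𝔸_ℚ / ℚˣ` of the adele class space of `ℚ`. -/
abbrev AdeleClassQuotient := Quotient adeleSetoid

/-- The class of an adele. -/
abbrev adeleClass (α : Adele) : AdeleClassQuotient := Quotient.mk adeleSetoid α

/-- The action of the idele class group on `Ẑˣ \ 𝔸_ℚ / ℚˣ` induced by the multiplication. -/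
instance : MulAction IdeleClass AdeleClassQuotient where
  smul c x := Quotient.liftOn₂' c x (fun g α => adeleClass (g • α)) (by
    rintro g α g' α' hg ⟨u, q, rfl⟩
    obtain ⟨q', hq'⟩ := QuotientGroup.leftRel_apply.1 hg
    obtain rfl : g' = g * principal q' := by rw [hq', mul_inv_cancel_left]
    refine Quotient.sound ⟨u, q * q', ?_⟩
    rw [smul_smul, smul_smul, map_mul]
    congr 1
    ac_rfl)
  one_smul := by
    rintro ⟨α⟩
    exact congrArg adeleClass (one_smul Adeleˣ α)
  mul_smul := by
    rintro ⟨g⟩ ⟨h⟩ ⟨α⟩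
    exact congrArg adeleClass (mul_smul g h α)

/-- The subgroup `H_a = {q ∈ ℚ | a q ∈ Ẑ}` of `ℚ` attached to a finite adele `a`. -/
def subgroupOf (a : FinAdele) : AddSubgroup ℚ where
  carrier := {q | a * algebraMap ℚ FinAdele q ∈ zHat}
  add_mem' hq hr := by
    simp only [Set.mem_ofPred_eq, map_add, mul_add] at *
    exact add_mem hq hr
  zero_mem' := by
    simp only [Set.mem_ofPred_eq, map_zero, mul_zero]
    exact zero_mem zHat
  neg_mem' hq := by
    simp only [Set.mem_ofPred_eq, map_neg, mul_neg] at *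
    exact neg_mem hq

/-- The point `(p, f)` over `RMax` of the arithmetic site is attached to the adele
`α = (r, a) ∈ ℝ × 𝔸^f`: the point `p` is the one of the ordered group `H_a`, that is, its flat
functor is identified by some `j` with the strictly positive part of `H_a`, in such a way that `f`
becomes the morphism `H_a ∪ {-∞} → RMax`, `h ↦ exp(|r| h)`. (Since `f` is a morphism of semirings
and `RMax` is a semifield, `f` is determined by its values on the elements `h > 0`.) -/
def IsAttached (P : RMaxPoint structureSheaf) (α : Adele) : Prop :=
  ∃ j : flatSet P.point ≃ {q : ℚ // q ∈ subgroupOf α.fin ∧ 0 < q},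
    (∀ (k : ℕ+) (x : flatSet P.point), (j (flatAct P.point k x) : ℚ) = k * (j x : ℚ)) ∧
    ∀ x : flatSet P.point,
      ((P.hom (toStalk P.point x)).val : ℝ) = Real.exp (|α.real| * ((j x : ℚ) : ℝ))

end ArithSite

end

/-!
A point `p` of a presheaf topos is determined by its restriction to the representable presheaves,
because `p^* F` is a tensor product: every element is some `s ⊗ x` with `s ∈ F(c)` and
`x ∈ p^*(yoneda c)`. For `ℕ^×` this restriction is a flat action on a set `X`. Any two elements of
`X` are multiples of a common third one, so that a homogeneous function on `X` is determined up to a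
constant, and `X` is the positive part of a subgroup `H` of `ℚ` containing `1`, unique up to scaling
by a positive rational number. Conversely every flat action comes from a point (Diaconescu).

A morphism from the stalk `O_p` to `ℝ_+^max` is determined by its values on `X`, and their logarithm
is a nonnegative homogeneous function, that is, `r ≥ 0` times the embedding of `X` in `ℚ`. On the
other side, a subgroup of `ℚ` containing `1` is determined by the set of denominators it allows at
each prime, hence is `H_a` for some `a ∈ Ẑ`, and `H_a` determines `a` up to `Ẑˣ`. Rescaling the
embedding of `X` is the action of `ℚˣ` on the adele `(r, a)`, and the sign of `r` is absorbed by
`-1 ∈ ℚˣ` together with `-1 ∈ Ẑˣ`.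

The Frobenius `Fr_t` multiplies `r` by `t`. If it fixes the class of `(r, a)` with `r ≠ 0`, then `t`
is rational; taking `t = √2` shows that the points fixed by all `Fr_t` have `r = 0`.
-/

noncomputable section

namespace ArithSite

/-! ### Points of a presheaf topos and flat functors -/

namespace ToposPoint

universe u

variable {C : Type u} [SmallCategory C] (p : ToposPoint C)

/-- The element `s ⊗ x` of `p^* F` attached to a section `s ∈ F(c)` and an element `x` of
`p^*(yoneda c)`: it exhibits `p^* F` as a tensor product over `C`. -/
def tmul {F : Cᵒᵖ ⥤ Type u} {c : C} (s : F.obj (op c))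
    (x : p.inverseImage.obj (yoneda.obj c)) : p.inverseImage.obj F :=
  p.inverseImage.map (yonedaEquiv.symm s) x

theorem map_tmul {F G : Cᵒᵖ ⥤ Type u} (η : F ⟶ G) {c : C} (s : F.obj (op c))
    (x : p.inverseImage.obj (yoneda.obj c)) :
    p.inverseImage.map η (p.tmul s x) = p.tmul (η.app (op c) s) x := by
  rw [tmul, tmul, ← yonedaEquiv_symm_naturality_right, Functor.map_comp]
  rfl

theorem tmul_map {F : Cᵒᵖ ⥤ Type u} {c d : C} (g : c ⟶ d) (s : F.obj (op d))
    (x : p.inverseImage.obj (yoneda.obj c)) :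
    p.tmul (F.map g.op s) x = p.tmul s (p.inverseImage.map (yoneda.map g) x) := by
  rw [tmul, tmul, ← yonedaEquiv_symm_naturality_left, Functor.map_comp]
  rfl

theorem tmul_yoneda {c d : C} (g : c ⟶ d) (x : p.inverseImage.obj (yoneda.obj c)) :
    p.tmul (F := yoneda.obj d) g x = p.inverseImage.map (yoneda.map g) x := by
  rw [tmul, (Equiv.symm_apply_eq yonedaEquiv).2 (yonedaEquiv_yoneda_map g).symm]

theorem hom_ext {F : Cᵒᵖ ⥤ Type u} {S : Type u} {f g : p.inverseImage.obj F ⟶ S}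
    (h : ∀ (c : C) (s : F.obj (op c)) (x : p.inverseImage.obj (yoneda.obj c)),
      f (p.tmul s x) = g (p.tmul s x)) : f = g := by
  apply (p.adj.homEquiv _ _).injective
  apply hom_ext_yoneda
  intro c s
  rw [← Adjunction.homEquiv_naturality_left, ← Adjunction.homEquiv_naturality_left]
  congr 1
  ext x
  have hx := h c (yonedaEquiv s) x
  rwa [tmul, Equiv.symm_apply_apply] at hx

/-- The elements `s ⊗ x` exhaust `p^* F` because the characteristic map of the set they form
agrees with the constant map `True` on all of them. -/
theorem exists_tmul {F : Cᵒᵖ ⥤ Type u} (t : p.inverseImage.obj F) :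
    ∃ (c : C) (s : F.obj (op c)) (x : p.inverseImage.obj (yoneda.obj c)), p.tmul s x = t := by
  have h := p.hom_ext (F := F) (S := ULift.{u} Prop)
    (f := ↾fun t => ⟨∃ (c : C) (s : F.obj (op c)) (x : p.inverseImage.obj (yoneda.obj c)),
      p.tmul s x = t⟩) (g := ↾fun _ => ⟨True⟩)
    fun c s x => congrArg ULift.up (eq_true ⟨c, s, x, rfl⟩)
  exact of_eq_true (congrArg ULift.down (ConcreteCategory.congr_hom h t))

theorem exists_nonempty_yoneda :
    ∃ c : C, Nonempty (p.inverseImage.obj (yoneda.obj c)) := by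
  obtain ⟨c, -, x, -⟩ := p.exists_tmul (default : p.inverseImage.obj (terminalPresheaf C))
  exact ⟨c, ⟨x⟩⟩

section Desc

variable {F : Cᵒᵖ ⥤ Type u} {S : Type u}
  (φ : ∀ c : C, F.obj (op c) → p.inverseImage.obj (yoneda.obj c) → S)
  (hφ : ∀ (c d : C) (g : c ⟶ d) (s : F.obj (op d)) (x : p.inverseImage.obj (yoneda.obj c)),
    φ c (F.map g.op s) x = φ d s (p.inverseImage.map (yoneda.map g) x))

/-- The map out of `p^* F` given by a balanced family of maps, that is, the universal property
of the tensor product. -/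
def desc : p.inverseImage.obj F ⟶ S :=
  (p.adj.homEquiv _ _).symm
    { app := fun c => ↾fun s => yonedaEquiv (p.adj.homEquiv (yoneda.obj c.unop) S (↾(φ c.unop s)))
      naturality := by
        intro c d g
        ext s
        change yonedaEquiv (p.adj.homEquiv (yoneda.obj d.unop) S (↾(φ d.unop (F.map g s)))) =
          (p.directImage.obj S).map g
            (yonedaEquiv (p.adj.homEquiv (yoneda.obj c.unop) S (↾(φ c.unop s))))
        rw [yonedaEquiv_naturality', ← Adjunction.homEquiv_naturality_left]
        congr 2
        ext x
        exact hφ _ _ g.unop s x }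

theorem desc_tmul {c : C} (s : F.obj (op c)) (x : p.inverseImage.obj (yoneda.obj c)) :
    p.desc φ hφ (p.tmul s x) = φ c s x := by
  have h : p.inverseImage.map (yonedaEquiv.symm s) ≫ p.desc φ hφ = ↾(φ c s) := by
    rw [desc, ← Adjunction.homEquiv_naturality_left_symm, Equiv.symm_apply_eq]
    apply yonedaEquiv.injective
    rw [yonedaEquiv_comp]
    simp
  exact ConcreteCategory.congr_hom h x

end Desc

section Hom

variable {p} {q : ToposPoint C}

/-- A morphism of points is given by its restriction to the representable presheaves. -/
def homOfYoneda (e : yoneda ⋙ p.inverseImage ⟶ yoneda ⋙ q.inverseImage) :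
    p.inverseImage ⟶ q.inverseImage where
  app F := p.desc (fun c s x => q.tmul s (e.app c x)) fun c d g s x => by
    rw [tmul_map]
    exact congrArg (q.tmul s) (ConcreteCategory.congr_hom (e.naturality g) x).symm
  naturality F G η := by
    apply p.hom_ext
    intro c s x
    rw [ConcreteCategory.comp_apply, ConcreteCategory.comp_apply, map_tmul, desc_tmul, desc_tmul,
      map_tmul]

theorem homOfYoneda_app_tmul (e : yoneda ⋙ p.inverseImage ⟶ yoneda ⋙ q.inverseImage)
    {F : Cᵒᵖ ⥤ Type u} {c : C} (s : F.obj (op c)) (x : p.inverseImage.obj (yoneda.obj c)) :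
    (homOfYoneda e).app F (p.tmul s x) = q.tmul s (e.app c x) := by
  dsimp only [homOfYoneda]
  rw [desc_tmul]

theorem homOfYoneda_comp_eq_id {e : yoneda ⋙ p.inverseImage ⟶ yoneda ⋙ q.inverseImage}
    {e' : yoneda ⋙ q.inverseImage ⟶ yoneda ⋙ p.inverseImage} (h : e ≫ e' = 𝟙 _) :
    homOfYoneda e ≫ homOfYoneda e' = 𝟙 _ := by
  ext F : 2
  apply p.hom_ext
  intro c s x
  rw [NatTrans.comp_app, ConcreteCategory.comp_apply, homOfYoneda_app_tmul, homOfYoneda_app_tmul]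
  exact congrArg (p.tmul s) (ConcreteCategory.congr_hom (NatTrans.congr_app h c) x)

/-- An isomorphism of points is given by its restriction to the representable presheaves. -/
def isoOfYoneda (e : yoneda ⋙ p.inverseImage ≅ yoneda ⋙ q.inverseImage) :
    p.inverseImage ≅ q.inverseImage where
  hom := homOfYoneda e.hom
  inv := homOfYoneda e.inv
  hom_inv_id := homOfYoneda_comp_eq_id e.hom_inv_id
  inv_hom_id := homOfYoneda_comp_eq_id e.inv_hom_id

end Hom

section OfFlat

variable (A : C ⥤ Type u) [IsCofiltered A.Elements]

/-- A flat functor, as a point of the site `C` with the trivial topology. -/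
def sitePointOfFlat : GrothendieckTopology.Point.{u} (⊥ : GrothendieckTopology C) where
  fiber := A
  isCofiltered := inferInstance
  initiallySmall := initiallySmall_of_essentiallySmall _
  jointly_surjective {U} R hR x := by
    obtain rfl : R = ⊤ := by simpa using hR
    exact ⟨U, 𝟙 _, trivial, x, ConcreteCategory.congr_hom (A.map_id U) x⟩

/-- The point of the presheaf topos on `C` attached to a flat functor, by Diaconescu. -/
def ofFlat : ToposPoint C where
  inverseImage := (sitePointOfFlat A).presheafFiber
  directImage := (sitePointOfFlat A).skyscraperPresheafFunctor
  adj := (sitePointOfFlat A).skyscraperPresheafAdjunction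
  leftExact := inferInstance

/-- The flat functor of the point attached to a flat functor is the given one. -/
def yonedaOfFlatIso : yoneda ⋙ (ofFlat A).inverseImage ≅ A :=
  Functor.isoWhiskerRight shrinkYonedaIsoYoneda.symm _ ≪≫
    (sitePointOfFlat A).shrinkYonedaCompPresheafFiberIso

end OfFlat

end ToposPoint

/-! ### Flat actions of a monoid -/

/-- The action of `M` on the set `p^*(rep)` of a point `p` of the topos of presheaves on `M`. -/
instance flatMulAction {M : Type} [Monoid M] (p : ToposPoint (SingleObj M)) :
    MulAction M (p.inverseImage.obj (yoneda.obj (SingleObj.star M))) where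
  smul k x := p.inverseImage.map (yoneda.map (SingleObj.toEnd M k)) x
  one_smul x := by
    change p.inverseImage.map (yoneda.map (SingleObj.toEnd M 1)) x = x
    rw [map_one, End.one_def, yoneda.map_id, CategoryTheory.Functor.map_id]
    rfl
  mul_smul k l x := by
    change p.inverseImage.map (yoneda.map (SingleObj.toEnd M (k * l))) x = _
    rw [map_mul, End.mul_def, yoneda.map_comp, Functor.map_comp]
    rfl

/-- The conditions on an action of `M` on `X` for the associated functor `M ⥤ Type` to be flat,
that is, for its category of elements to be cofiltered. -/
structure IsFlatAction (M X : Type*) [Monoid M] [MulAction M X] : Prop where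
  nonempty : Nonempty X
  exists_common_divisor : ∀ x y : X, ∃ (z : X) (k l : M), k • z = x ∧ l • z = y
  exists_equalizer : ∀ (x : X) (k l : M), k • x = l • x →
    ∃ (z : X) (m : M), m • z = x ∧ k * m = l * m

section FlatAction

variable {M X : Type} [Monoid M] [MulAction M X]

theorem isFlatAction_flatMulAction (p : ToposPoint (SingleObj M)) :
    IsFlatAction M (p.inverseImage.obj (yoneda.obj (SingleObj.star M))) where
  nonempty := p.exists_nonempty_yoneda.choose_spec
  exists_common_divisor x y := by
    obtain ⟨t, rfl, rfl⟩ := p.exists_two x y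
    obtain ⟨_, s, z, rfl⟩ := p.exists_tmul t
    rw [p.map_tmul, p.map_tmul]
    exact ⟨z, s.1, s.2, (p.tmul_yoneda _ z).symm, (p.tmul_yoneda _ z).symm⟩
  exists_equalizer x k l h := by
    let f := yoneda.map (SingleObj.toEnd M k)
    let g := yoneda.map (SingleObj.toEnd M l)
    have hlim := Limits.isLimitForkMapOfIsLimit p.inverseImage _ (Limits.equalizerIsEqualizer f g)
    obtain ⟨t, ht, -⟩ := (Limits.Types.type_equalizer_iff_unique _ _).1 ⟨hlim⟩ x h
    obtain ⟨c, s, z, rfl⟩ := p.exists_tmul t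
    refine ⟨z, (Limits.equalizer.ι f g).app (op c) s, ?_, ?_⟩
    · rw [← ht]
      exact ((p.map_tmul _ s z).trans (p.tmul_yoneda _ z)).symm
    · exact ConcreteCategory.congr_hom
        (NatTrans.congr_app (Limits.equalizer.condition f g) (op c)) s

theorem IsFlatAction.isCofiltered (h : IsFlatAction M X) :
    IsCofiltered (actionAsFunctor M X).Elements where
  nonempty := h.nonempty.map fun x => ⟨SingleObj.star M, x⟩
  cone_objs := by
    rintro ⟨⟨⟩, x⟩ ⟨⟨⟩, y⟩
    obtain ⟨z, k, l, hk, hl⟩ := h.exists_common_divisor x y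
    exact ⟨⟨SingleObj.star M, z⟩, ⟨k, hk⟩, ⟨l, hl⟩, trivial⟩
  cone_maps := by
    rintro ⟨⟨⟩, x⟩ ⟨⟨⟩, y⟩ ⟨k, hk⟩ ⟨l, hl⟩
    obtain ⟨z, m, hm, hkl⟩ := h.exists_equalizer x k l (hk.trans hl.symm)
    exact ⟨⟨SingleObj.star M, z⟩, ⟨m, hm⟩, Subtype.ext hkl⟩

theorem IsFlatAction.exists_point (h : IsFlatAction M X) :
    ∃ (p : ToposPoint (SingleObj M))
      (e : p.inverseImage.obj (yoneda.obj (SingleObj.star M)) ≃ X),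
      ∀ (k : M) x, e (k • x) = k • e x := by
  have := h.isCofiltered
  let i := ToposPoint.yonedaOfFlatIso (actionAsFunctor M X)
  exact ⟨.ofFlat (actionAsFunctor M X), (i.app (SingleObj.star M)).toEquiv, fun k x =>
    ConcreteCategory.congr_hom (i.hom.naturality (SingleObj.toEnd M k)) x⟩

end FlatAction

/-! ### Stalks of a sheaf of semirings -/

namespace Stalk

universe u

variable {C : Type u} [SmallCategory C] {O : Cᵒᵖ ⥤ CommSemiRingCat.{u}} {p : ToposPoint C}

/-- The morphism of semirings `O(c) → O_p` given by an element of `p^*(yoneda c)`. -/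
def germHom {c : C} (x : p.inverseImage.obj (yoneda.obj c)) : O.obj (op c) →+* Stalk O p where
  toFun s := germ (yonedaEquiv.symm s) x
  map_zero' := by
    rw [zero_eq x]
    exact germ_congr x fun _ g => map_zero (O.map (Quiver.Hom.op g)).hom
  map_one' := by
    rw [one_eq x]
    exact germ_congr x fun _ g => map_one (O.map (Quiver.Hom.op g)).hom
  map_mul' s t := by
    rw [germ_mul]
    exact germ_congr x fun _ g => map_mul (O.map (Quiver.Hom.op g)).hom s t
  map_add' s t := by
    rw [germ_add]
    exact germ_congr x fun _ g => map_add (O.map (Quiver.Hom.op g)).hom s t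

theorem germHom_map {c d : C} (g : c ⟶ d) (s : O.obj (op d))
    (x : p.inverseImage.obj (yoneda.obj c)) :
    germHom x ((O.map g.op).hom s) = germHom (p.inverseImage.map (yoneda.map g) x) s :=
  p.tmul_map (F := underlying O) g s x

theorem exists_germHom (a : Stalk O p) :
    ∃ (c : C) (x : p.inverseImage.obj (yoneda.obj c)) (s : O.obj (op c)), germHom x s = a := by
  obtain ⟨c, s, x, rfl⟩ := p.exists_tmul (F := underlying O) a
  exact ⟨c, x, s, rfl⟩

theorem exists_germHom_two (a b : Stalk O p) :
    ∃ (c : C) (x : p.inverseImage.obj (yoneda.obj c)) (s t : O.obj (op c)),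
      germHom x s = a ∧ germHom x t = b := by
  obtain ⟨w, rfl, rfl⟩ := exists_two a b
  obtain ⟨c, s, x, rfl⟩ := p.exists_tmul w
  exact ⟨c, x, s.1, s.2, (p.map_tmul FunctorToTypes.prod.fst s x).symm,
    (p.map_tmul FunctorToTypes.prod.snd s x).symm⟩

variable {R : Type u} [CommSemiring R]

section Lift

variable (φ : ∀ c : C, p.inverseImage.obj (yoneda.obj c) → (O.obj (op c) →+* R))
  (hφ : ∀ (c d : C) (g : c ⟶ d) (x : p.inverseImage.obj (yoneda.obj c)),
    (φ c x).comp (O.map g.op).hom = φ d (p.inverseImage.map (yoneda.map g) x))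

/-- The map underlying `Stalk.lift`. -/
def liftFun : Stalk O p → R :=
  p.desc (F := underlying O) (fun c s x => φ c x s) fun c d g s x =>
    RingHom.congr_fun (hφ c d g x) s

theorem liftFun_germHom {c : C} (x : p.inverseImage.obj (yoneda.obj c)) (s : O.obj (op c)) :
    liftFun φ hφ (germHom x s) = φ c x s :=
  p.desc_tmul (F := underlying O) _ _ s x

/-- The morphism of semirings out of the stalk given by a balanced family of morphisms. -/
def lift : Stalk O p →+* R where
  toFun := liftFun φ hφ
  map_zero' := by
    obtain ⟨c, ⟨x⟩⟩ := p.exists_nonempty_yoneda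
    rw [← map_zero (germHom x), liftFun_germHom, map_zero]
  map_one' := by
    obtain ⟨c, ⟨x⟩⟩ := p.exists_nonempty_yoneda
    rw [← map_one (germHom x), liftFun_germHom, map_one]
  map_mul' a b := by
    obtain ⟨c, x, s, t, rfl, rfl⟩ := exists_germHom_two a b
    rw [← map_mul, liftFun_germHom, liftFun_germHom, liftFun_germHom, map_mul]
  map_add' a b := by
    obtain ⟨c, x, s, t, rfl, rfl⟩ := exists_germHom_two a b
    rw [← map_add, liftFun_germHom, liftFun_germHom, liftFun_germHom, map_add]

theorem lift_germHom {c : C} (x : p.inverseImage.obj (yoneda.obj c)) (s : O.obj (op c)) :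
    lift φ hφ (germHom x s) = φ c x s :=
  liftFun_germHom φ hφ x s

end Lift

end Stalk

/-! ### Morphisms from the tropical integers -/

namespace ZMax

/-- The generator `1` of the group of units `ℤ` of the tropical integers. -/
def gen : ZMaxˣ := ⟨mk (1 : ℤ), mk (-1 : ℤ), rfl, rfl⟩

theorem coe_gen_zpow (n : ℤ) : (↑(gen ^ n) : ZMax) = mk n := by
  let ofInt : Multiplicative ℤ →* ZMax := ⟨⟨fun n => mk n.toAdd, rfl⟩, fun _ _ => rfl⟩
  have hgen : gen = ofInt.toHomUnits (.ofAdd 1) := Units.ext rfl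
  rw [hgen, ← map_zpow, ← ofAdd_zsmul, smul_eq_mul, mul_one]
  rfl

@[elab_as_elim]
theorem induction {motive : ZMax → Prop} (zero : motive 0)
    (zpow : ∀ n : ℤ, motive ↑(gen ^ n)) (x : ZMax) : motive x := by
  induction x using WithBot.recBotCoe with
  | bot => exact zero
  | coe n =>
    have h := zpow n
    rw [coe_gen_zpow] at h
    exact h

theorem frob_gen (k : ℕ+) : frob k gen = ↑(gen ^ (k : ℕ)) := by
  rw [← zpow_natCast, coe_gen_zpow]
  exact congrArg (fun n : ℤ => mk n) (mul_one _)

theorem gen_add_one : (gen : ZMax) + 1 = gen := rfl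

variable {R : Type*} [CommSemiring R]

theorem hom_ext {f g : ZMax →+* R} (h : f gen = g gen) : f = g := by
  have hgen : Units.map (f : ZMax →* R) gen = Units.map (g : ZMax →* R) gen := Units.ext h
  refine RingHom.ext fun x => ?_
  induction x using ZMax.induction with
  | zero => rw [map_zero, map_zero]
  | zpow n =>
    have hpow := congrArg (fun u : Rˣ => (↑(u ^ n) : R)) hgen
    simp only [← map_zpow] at hpow
    exact hpow

end ZMax

section Lift

variable {R : Type*} [CommSemiring R]

theorem zpow_add_zpow_eq_zpow_max {b : Rˣ} (hone : (1 : R) + 1 = 1) (hb : (b : R) + 1 = b)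
    (m n : ℤ) : (↑(b ^ m) + ↑(b ^ n) : R) = ↑(b ^ max m n) := by
  have hpow (k : ℕ) : (b : R) ^ k + 1 = b ^ k := by
    induction k with
    | zero => rwa [pow_zero]
    | succ k ih =>
      calc (b : R) ^ (k + 1) + 1 = b ^ k * (b + 1) + 1 := by rw [hb, pow_succ]
        _ = b ^ (k + 1) + (b ^ k + 1) := by rw [mul_add, mul_one, pow_succ, add_assoc]
        _ = b ^ k * (b + 1) := by rw [ih, mul_add, mul_one, pow_succ]
        _ = b ^ (k + 1) := by rw [hb, pow_succ]
  wlog hmn : m ≤ n generalizing m n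
  · rw [add_comm, max_comm, this n m (le_of_not_ge hmn)]
  obtain ⟨k, rfl⟩ := Int.le.dest hmn
  rw [max_eq_right hmn, zpow_add, zpow_natCast, Units.val_mul, Units.val_pow_eq_pow_val]
  calc (↑(b ^ m) + ↑(b ^ m) * ↑b ^ k : R) = ↑(b ^ m) * (↑b ^ k + 1) := by
        rw [mul_add, mul_one, add_comm]
    _ = ↑(b ^ m) * ↑b ^ k := by rw [hpow]

namespace ZMax

/-- The map underlying `ZMax.lift`. -/
def liftFun (b : Rˣ) (x : ZMax) : R :=
  WithBot.recBotCoe (C := fun _ => R) 0 (fun n : ℤ => ↑(b ^ n)) x.val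

theorem liftFun_zero (b : Rˣ) : liftFun b 0 = 0 := rfl

theorem liftFun_zpow (b : Rˣ) (n : ℤ) : liftFun b ↑(gen ^ n) = ↑(b ^ n) := by
  rw [coe_gen_zpow]
  rfl

/-- The morphism of semirings `n ↦ b ^ n`, `-∞ ↦ 0` out of the tropical integers. -/
def lift (b : Rˣ) (hone : (1 : R) + 1 = 1) (hb : (b : R) + 1 = b) : ZMax →+* R where
  toFun := liftFun b
  map_zero' := liftFun_zero b
  map_one' := congrArg Units.val (zpow_zero b)
  map_mul' x y := by
    induction x using ZMax.induction with
    | zero => rw [zero_mul, liftFun_zero, zero_mul]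
    | zpow m =>
      induction y using ZMax.induction with
      | zero => rw [mul_zero, liftFun_zero, mul_zero]
      | zpow n =>
        simp only [← Units.val_mul, ← zpow_add, liftFun_zpow]
  map_add' x y := by
    induction x using ZMax.induction with
    | zero => rw [zero_add, liftFun_zero, zero_add]
    | zpow m =>
      induction y using ZMax.induction with
      | zero => rw [add_zero, liftFun_zero, add_zero]
      | zpow n =>
        rw [zpow_add_zpow_eq_zpow_max rfl gen_add_one, liftFun_zpow, liftFun_zpow, liftFun_zpow,
          zpow_add_zpow_eq_zpow_max hone hb]

theorem lift_gen (b : Rˣ) (hone : (1 : R) + 1 = 1) (hb : (b : R) + 1 = b) :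
    lift b hone hb gen = b := congrArg Units.val (zpow_one b)

end ZMax

end Lift

/-! ### Morphisms from the stalks of the structure sheaf -/

section StructureSheaf

variable {p : ToposPoint (SingleObj ℕ+)}

/-- The morphism of semirings from the tropical integers to the stalk of the structure sheaf
given by an element of the flat set of the point. -/
def germZMax (x : flatSet p) : ZMax →+* Stalk structureSheaf p :=
  Stalk.germHom (O := structureSheaf) x

theorem germZMax_gen (x : flatSet p) : germZMax x ZMax.gen = toStalk p x := rfl

theorem exists_germZMax (s : Stalk structureSheaf p) : ∃ x n, germZMax x n = s := by
  obtain ⟨_, x, n, rfl⟩ := Stalk.exists_germHom s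
  exact ⟨x, n, rfl⟩

theorem toStalk_smul (k : ℕ+) (x : flatSet p) : toStalk p (k • x) = toStalk p x ^ (k : ℕ) := by
  have h : germZMax x (ZMax.frob k ZMax.gen) = toStalk p (k • x) :=
    Stalk.germHom_map (O := structureSheaf) (SingleObj.toEnd ℕ+ k) ZMax.gen.val x
  rw [← h, ZMax.frob_gen, Units.val_pow_eq_pow_val, map_pow, germZMax_gen]

theorem toStalk_add_one (x : flatSet p) : toStalk p x + 1 = toStalk p x := by
  rw [← germZMax_gen, ← map_one (germZMax x), ← map_add, ZMax.gen_add_one]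

/-- `toStalk`, with values in the group of units of the stalk. -/
def toStalkUnits (x : flatSet p) : (Stalk structureSheaf p)ˣ :=
  Units.map (germZMax x : ZMax →* Stalk structureSheaf p) ZMax.gen

theorem eq_zero_or_exists_zpow (s : Stalk structureSheaf p) :
    s = 0 ∨ ∃ (x : flatSet p) (n : ℤ), s = ↑(toStalkUnits x ^ n) := by
  obtain ⟨x, s, rfl⟩ := exists_germZMax s
  induction s using ZMax.induction with
  | zero => exact .inl (map_zero _)
  | zpow n =>
    exact .inr ⟨x, n, congrArg Units.val
      (map_zpow (Units.map (germZMax x : ZMax →* Stalk structureSheaf p)) ZMax.gen n)⟩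

variable {R : Type} [CommSemiring R]

theorem exists_stalkHom (hone : (1 : R) + 1 = 1) (b : flatSet p → Rˣ)
    (hsmul : ∀ (k : ℕ+) x, b (k • x) = b x ^ (k : ℕ)) (hadd : ∀ x, (b x : R) + 1 = b x) :
    ∃ f : Stalk structureSheaf p →+* R, ∀ x, f (toStalk p x) = b x := by
  let φ (x : flatSet p) : ZMax →+* R := ZMax.lift (b x) hone (hadd x)
  have hφ (k : ℕ+) (x : flatSet p) : (φ x).comp (ZMax.frob k) = φ (k • x) := by
    apply ZMax.hom_ext
    rw [RingHom.comp_apply, ZMax.frob_gen, Units.val_pow_eq_pow_val, map_pow, ZMax.lift_gen,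
      ZMax.lift_gen, hsmul, Units.val_pow_eq_pow_val]
  refine ⟨Stalk.lift (O := structureSheaf) (fun _ x => φ x) fun _ _ k x => hφ k x, fun x => ?_⟩
  exact (Stalk.lift_germHom (O := structureSheaf) _ _ x ZMax.gen.val).trans (ZMax.lift_gen _ _ _)

end StructureSheaf

/-! ### Points over the tropical reals -/

namespace RMax

/-- The exponential, as a morphism from the additive group of the reals to the group of units of
the tropical reals. -/
def exp : Multiplicative ℝ →* RMaxˣ :=
  MonoidHom.toHomUnits
    { toFun := fun c => mk ⟨Real.exp c.toAdd, (Real.exp_pos _).le⟩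
      map_one' := NNReal.coe_injective Real.exp_zero
      map_mul' := fun c d => NNReal.coe_injective (Real.exp_add c.toAdd d.toAdd) }

theorem coe_val_exp (c : ℝ) : ((exp (.ofAdd c) : RMax).val : ℝ) = Real.exp c := rfl

theorem eq_exp_iff {x : RMax} {c : ℝ} : x = exp (.ofAdd c) ↔ (x.val : ℝ) = Real.exp c :=
  NNReal.coe_injective.eq_iff.symm

theorem eq_exp_log (u : RMaxˣ) : (u : RMax) = exp (.ofAdd (Real.log (u : RMax).val)) := by
  have hu : (u : RMax).val ≠ 0 := fun h => one_ne_zero (α := ℝ≥0) <| by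
    have h1 : (u : RMax).val * (↑u⁻¹ : RMax).val = 1 := u.mul_inv
    rw [← h1, h, zero_mul]
  rw [eq_exp_iff, Real.exp_log (NNReal.coe_pos.2 (pos_iff_ne_zero.2 hu))]

theorem exp_intCast_mul (n : ℤ) (c : ℝ) : exp (.ofAdd (n * c)) = exp (.ofAdd c) ^ n := by
  rw [← zsmul_eq_mul, ofAdd_zsmul, map_zpow]

theorem exp_natCast_mul (n : ℕ) (c : ℝ) : exp (.ofAdd (n * c)) = exp (.ofAdd c) ^ n := by
  rw [← nsmul_eq_mul, ofAdd_nsmul, map_pow]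

theorem exp_injective : Function.Injective fun c : ℝ => (exp (.ofAdd c) : RMax) := fun _ _ h =>
  Real.exp_injective (eq_exp_iff.1 h)

theorem one_add_one : (1 : RMax) + 1 = 1 := max_self (1 : ℝ≥0)

theorem exp_add_one_eq_iff {c : ℝ} :
    (exp (.ofAdd c) : RMax) + 1 = exp (.ofAdd c) ↔ 0 ≤ c := by
  rw [eq_exp_iff, ← Real.one_le_exp_iff, ← max_eq_left_iff]
  exact Iff.of_eq (congrArg (· = Real.exp c) (NNReal.coe_max _ 1))

theorem frob_exp (t : {t : ℝ // 0 < t}) (c : ℝ) :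
    frob t (exp (.ofAdd c)) = exp (.ofAdd (t * c)) := by
  rw [eq_exp_iff, mul_comm, Real.exp_mul]
  exact NNReal.coe_rpow _ _

end RMax

namespace RMaxPoint

variable (P : RMaxPoint structureSheaf)

/-- The logarithm of the value at `x`: the homogeneous function on the flat set of the point which
determines the morphism from the stalk. -/
def logValue (x : flatSet P.point) : ℝ :=
  Real.log (P.hom (toStalk P.point x)).val

theorem hom_toStalkUnits (x : flatSet P.point) :
    Units.map (P.hom : Stalk structureSheaf P.point →* RMax) (toStalkUnits x) =
      RMax.exp (.ofAdd (P.logValue x)) :=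
  Units.ext (RMax.eq_exp_log (Units.map (P.hom : _ →* RMax) (toStalkUnits x)))

theorem hom_toStalk (x : flatSet P.point) :
    P.hom (toStalk P.point x) = RMax.exp (.ofAdd (P.logValue x)) :=
  congrArg Units.val (P.hom_toStalkUnits x)

theorem hom_zpow_toStalkUnits (x : flatSet P.point) (n : ℤ) :
    P.hom ↑(toStalkUnits x ^ n) = RMax.exp (.ofAdd (n * P.logValue x)) := by
  rw [RMax.exp_intCast_mul, ← hom_toStalkUnits, ← map_zpow]
  rfl

variable {P}

theorem logValue_eq_iff {x : flatSet P.point} {c : ℝ} :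
    P.logValue x = c ↔ P.hom (toStalk P.point x) = RMax.exp (.ofAdd c) := by
  rw [hom_toStalk, ← RMax.exp_injective.eq_iff]

variable (P)

theorem logValue_smul (k : ℕ+) (x : flatSet P.point) :
    P.logValue (k • x) = k * P.logValue x := by
  rw [logValue_eq_iff, toStalk_smul, map_pow, hom_toStalk, RMax.exp_natCast_mul,
    Units.val_pow_eq_pow_val]

theorem logValue_nonneg (x : flatSet P.point) : 0 ≤ P.logValue x := by
  rw [← RMax.exp_add_one_eq_iff, ← hom_toStalk, ← map_one P.hom, ← map_add, toStalk_add_one]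

theorem logValue_frob (t : {t : ℝ // 0 < t}) (x : flatSet P.point) :
    (P.frob t).logValue x = t * P.logValue x := by
  refine logValue_eq_iff.2 ?_
  rw [← RMax.frob_exp, ← hom_toStalk]
  rfl

theorem logRange_eq : P.logRange = {y | ∃ (x : _) (n : ℤ), y = n * P.logValue x} := by
  ext y
  constructor
  · rintro ⟨s, hs, rfl⟩
    obtain rfl | ⟨x, n, rfl⟩ := eq_zero_or_exists_zpow s
    · exact absurd (map_zero P.hom) hs
    · refine ⟨x, n, ?_⟩
      rw [hom_zpow_toStalkUnits, RMax.coe_val_exp, Real.log_exp]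
  · rintro ⟨x, n, rfl⟩
    have hval := P.hom_zpow_toStalkUnits x n
    refine ⟨↑(toStalkUnits x ^ n), fun h => ?_, ?_⟩
    · exact (Real.exp_pos _).ne (RMax.eq_exp_iff.1 (h.symm.trans hval))
    · rw [hval, RMax.coe_val_exp, Real.log_exp]

theorem isDegenerate_iff : P.IsDegenerate ↔ ∀ x, P.logValue x = 0 := by
  constructor
  · intro h x
    rw [logValue_eq_iff, ofAdd_zero, map_one]
    refine (h (toStalk P.point x)).resolve_left fun h0 => ?_
    exact (Real.exp_pos _).ne (RMax.eq_exp_iff.1 (h0.symm.trans (P.hom_toStalk x)))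
  · intro h s
    obtain rfl | ⟨x, n, rfl⟩ := eq_zero_or_exists_zpow s
    · exact .inl (map_zero P.hom)
    · right
      rw [hom_zpow_toStalkUnits, h, mul_zero, ofAdd_zero, map_one, Units.val_one]

theorem exists_logValue_eq {p : ToposPoint (SingleObj ℕ+)} {c : flatSet p → ℝ}
    (hc : ∀ (k : ℕ+) x, c (k • x) = k * c x) (hc0 : ∀ x, 0 ≤ c x) :
    ∃ f : Stalk structureSheaf p →+* RMax, (mk p f).logValue = c := by
  obtain ⟨f, hf⟩ := exists_stalkHom RMax.one_add_one (fun x => RMax.exp (.ofAdd (c x)))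
    (fun k x => by rw [hc, RMax.exp_natCast_mul]) fun x => RMax.exp_add_one_eq_iff.2 (hc0 x)
  exact ⟨f, funext fun x => logValue_eq_iff.2 (hf x)⟩

variable {P} {Q : RMaxPoint structureSheaf}

theorem equiv_iff : P ≈ Q ↔ ∃ e : flatSet P.point ≃ flatSet Q.point,
    (∀ (k : ℕ+) x, e (k • x) = k • e x) ∧ ∀ x, Q.logValue (e x) = P.logValue x := by
  constructor
  · rintro ⟨φ, hφ⟩
    refine ⟨(φ.app rep).toEquiv, fun k x => ?_, fun x => ?_⟩
    · exact ConcreteCategory.congr_hom (φ.hom.naturality (yoneda.map (SingleObj.toEnd ℕ+ k))) x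
    · rw [logValue_eq_iff, ← hom_toStalk]
      refine Eq.trans ?_ (hφ _)
      exact congrArg Q.hom (ConcreteCategory.congr_hom (φ.hom.naturality unitSection) x).symm
  · rintro ⟨e, he, hlog⟩
    let ε : yoneda ⋙ P.point.inverseImage ≅ yoneda ⋙ Q.point.inverseImage :=
      NatIso.ofComponents (fun _ => e.toIso) fun k => by
        ext x
        exact he k x
    refine ⟨ToposPoint.isoOfYoneda ε, fun s => ?_⟩
    obtain ⟨x, n, rfl⟩ := exists_germZMax s
    have hgerm : (ToposPoint.isoOfYoneda ε).hom.app (underlying structureSheaf)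
        (germZMax x n) = germZMax (e x) n :=
      ToposPoint.homOfYoneda_app_tmul (F := underlying structureSheaf) ε.hom n x
    have hhom : Q.hom.comp (germZMax (e x)) = P.hom.comp (germZMax x) := ZMax.hom_ext <| by
      rw [RingHom.comp_apply, RingHom.comp_apply, germZMax_gen, germZMax_gen, hom_toStalk, hlog,
        hom_toStalk]
    rw [hgerm]
    exact RingHom.congr_fun hhom n

end RMaxPoint

/-! ### Flat actions of the positive integers and subgroups of the rationals -/

theorem IsFlatAction.smul_left_injective {M X : Type*} [Monoid M] [IsRightCancelMul M]
    [MulAction M X] (h : IsFlatAction M X) (x : X) : Function.Injective fun k : M => k • x := by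
  intro k l hkl
  obtain ⟨_, m, -, hm⟩ := h.exists_equalizer x k l hkl
  exact mul_right_cancel hm

theorem IsFlatAction.smul_eq_smul_iff {M X : Type*} [CommMonoid M] [IsCancelMul M] [MulAction M X]
    (h : IsFlatAction M X) {y z : X} {k l : M} (hkl : k • y = l • z) (m n : M) :
    m • y = n • z ↔ m * l = n * k := by
  obtain ⟨w, a, b, rfl, rfl⟩ := h.exists_common_divisor y z
  simp only [smul_smul, (h.smul_left_injective w).eq_iff] at hkl ⊢
  calc m * a = n * b ↔ m * a * l = n * b * l := (mul_left_inj l).symm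
    _ ↔ m * l * a = n * (l * b) := by rw [mul_right_comm, mul_assoc n, mul_comm b]
    _ ↔ m * l * a = n * k * a := by rw [← hkl, mul_assoc n]
    _ ↔ m * l = n * k := mul_left_inj a

namespace IsFlatAction

variable {X : Type*} [MulAction ℕ+ X]

theorem mul_comm_of_homogeneous (h : IsFlatAction ℕ+ X) {R : Type*} [CommSemiring R] {i j : X → R}
    (hi : ∀ (k : ℕ+) x, i (k • x) = k * i x) (hj : ∀ (k : ℕ+) x, j (k • x) = k * j x) (x y : X) :
    i x * j y = i y * j x := by
  obtain ⟨z, k, l, rfl, rfl⟩ := h.exists_common_divisor x y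
  rw [hi, hi, hj, hj]
  ring

theorem injective_of_homogeneous (h : IsFlatAction ℕ+ X) {R : Type*} [Semiring R] [CharZero R]
    [IsRightCancelMulZero R] {j : X → R} (hj : ∀ (k : ℕ+) x, j (k • x) = k * j x)
    (hne : ∀ x, j x ≠ 0) : Function.Injective j := by
  intro x y hxy
  obtain ⟨z, k, l, rfl, rfl⟩ := h.exists_common_divisor x y
  rw [hj, hj] at hxy
  rw [PNat.coe_injective (Nat.cast_injective (mul_right_cancel₀ (hne z) hxy))]

theorem exists_homogeneous (h : IsFlatAction ℕ+ X) (x₀ : X) :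
    ∃ j : X → ℚ, (∀ (k : ℕ+) x, j (k • x) = k * j x) ∧ (∀ x, 0 < j x) ∧ j x₀ = 1 := by
  choose z k l hk hl using fun x => h.exists_common_divisor x x₀
  have hratio {x y : X} {m n : ℕ+} (hm : m • y = x) (hn : n • y = x₀) :
      (k x / l x : ℚ) = m / n := by
    have hmul := (h.smul_eq_smul_iff ((hl x).trans hn.symm) _ _).1 ((hk x).trans hm.symm)
    rw [div_eq_div_iff (Nat.cast_ne_zero.2 (l x).ne_zero) (Nat.cast_ne_zero.2 n.ne_zero)]
    exact_mod_cast hmul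
  refine ⟨fun x => k x / l x, fun n x => ?_, fun x => ?_, ?_⟩ <;> beta_reduce
  · rw [hratio (m := n * k x) (by rw [mul_smul, hk]) (hl x)]
    push_cast
    ring
  · exact div_pos (Nat.cast_pos.2 (k x).pos) (Nat.cast_pos.2 (l x).pos)
  · rw [hratio (one_smul ℕ+ x₀) (one_smul ℕ+ x₀), div_self (by simp)]

theorem mem_closure_range_iff (h : IsFlatAction ℕ+ X) {R : Type*} [Ring R] {j : X → R}
    (hj : ∀ (k : ℕ+) x, j (k • x) = k * j x) {r : R} :
    r ∈ AddSubgroup.closure (Set.range j) ↔ ∃ (x : X) (n : ℤ), r = n * j x := by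
  constructor
  · intro hr
    induction hr using AddSubgroup.closure_induction with
    | mem _ hr =>
      obtain ⟨x, rfl⟩ := hr
      exact ⟨x, 1, by rw [Int.cast_one, one_mul]⟩
    | zero =>
      obtain ⟨x⟩ := h.nonempty
      exact ⟨x, 0, by rw [Int.cast_zero, zero_mul]⟩
    | add _ _ _ _ ihr ihs =>
      obtain ⟨x, m, rfl⟩ := ihr
      obtain ⟨y, n, rfl⟩ := ihs
      obtain ⟨z, k, l, rfl, rfl⟩ := h.exists_common_divisor x y
      refine ⟨z, m * k + n * l, ?_⟩
      rw [hj, hj]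
      push_cast
      rw [add_mul, mul_assoc, mul_assoc]
    | neg _ _ ih =>
      obtain ⟨x, n, rfl⟩ := ih
      exact ⟨x, -n, by rw [Int.cast_neg, neg_mul]⟩
  · rintro ⟨x, n, rfl⟩
    rw [← zsmul_eq_mul]
    exact zsmul_mem (AddSubgroup.subset_closure (Set.mem_range_self x)) n

end IsFlatAction

/-- The strictly positive part of a subgroup `H` of `ℚ`: the flat set of the point of the topos
attached to the rank one ordered group `H`. -/
abbrev PosPart (H : AddSubgroup ℚ) : Type := {q : ℚ // q ∈ H ∧ 0 < q}

namespace PosPart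

variable {H : AddSubgroup ℚ}

instance : MulAction ℕ+ (PosPart H) where
  smul k q := ⟨k * q, by
    rw [← nsmul_eq_mul]
    exact ⟨nsmul_mem q.2.1 k, nsmul_pos q.2.2 k.ne_zero⟩⟩
  one_smul q := Subtype.ext <| by
    change ((1 : ℕ+) : ℚ) * q = q
    rw [PNat.one_coe, Nat.cast_one, one_mul]
  mul_smul k l q := Subtype.ext <| by
    change ((k * l : ℕ+) : ℚ) * q = k * (l * q)
    rw [PNat.mul_coe, Nat.cast_mul, mul_assoc]

theorem coe_smul (k : ℕ+) (q : PosPart H) : (↑(k • q) : ℚ) = k * q := rfl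

theorem closure_range_coe : AddSubgroup.closure (Set.range ((↑) : PosPart H → ℚ)) = H := by
  refine le_antisymm ((AddSubgroup.closure_le H).2 ?_) fun q hq => ?_
  · rintro _ ⟨q, rfl⟩
    exact q.2.1
  · obtain hneg | rfl | hpos := lt_trichotomy q 0
    · rw [← neg_mem_iff]
      exact AddSubgroup.subset_closure ⟨⟨-q, neg_mem hq, neg_pos.2 hneg⟩, rfl⟩
    · exact zero_mem _
    · exact AddSubgroup.subset_closure ⟨⟨q, hq, hpos⟩, rfl⟩

/-- A finitely generated subgroup of `ℚ` is cyclic, and a positive generator of `ℤ x + ℤ y`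
divides `x` and `y`. -/
theorem exists_common_divisor (x y : PosPart H) :
    ∃ (z : PosPart H) (k l : ℕ+), k • z = x ∧ l • z = y := by
  let I : FractionalIdeal (nonZeroDivisors ℤ) ℚ :=
    ⟨Submodule.span ℤ {(x : ℚ), (y : ℚ)},
      FractionalIdeal.isFractional_of_fg (Submodule.fg_span (Set.toFinite _))⟩
  obtain ⟨z, hz : Submodule.span ℤ {(x : ℚ), (y : ℚ)} = Submodule.span ℤ {z}⟩ :=
    (inferInstance : (I : Submodule ℤ ℚ).IsPrincipal)
  have hzH : z ∈ H := by
    have hle : Submodule.span ℤ {(x : ℚ), (y : ℚ)} ≤ AddSubgroup.toIntSubmodule H :=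
      Submodule.span_le.2 (Set.pair_subset x.2.1 y.2.1)
    exact hle (hz ▸ Submodule.mem_span_singleton_self z)
  have hdvd (w : PosPart H) (hw : (w : ℚ) ∈ Submodule.span ℤ {(x : ℚ), (y : ℚ)}) :
      ∃ k : ℕ+, (k : ℚ) * |z| = w := by
    rw [hz, Submodule.mem_span_singleton] at hw
    obtain ⟨m, hm⟩ := hw
    have hm0 : m ≠ 0 := by
      rintro rfl
      exact w.2.2.ne ((zero_smul ℤ z).symm.trans hm)
    refine ⟨⟨m.natAbs, Int.natAbs_pos.2 hm0⟩, ?_⟩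
    rw [PNat.mk_coe, Nat.cast_natAbs, Int.cast_abs, ← abs_mul, ← zsmul_eq_mul, hm,
      abs_of_pos w.2.2]
  obtain ⟨k, hk⟩ := hdvd x (Submodule.subset_span (.inl rfl))
  obtain ⟨l, hl⟩ := hdvd y (Submodule.subset_span (.inr rfl))
  have hz0 : 0 < |z| := pos_of_mul_pos_right (hk ▸ x.2.2) k.1.cast_nonneg
  exact ⟨⟨|z|, abs_mem_iff.2 hzH, hz0⟩, k, l, Subtype.ext hk, Subtype.ext hl⟩

theorem isFlatAction (hH : ∃ q ∈ H, 0 < q) : IsFlatAction ℕ+ (PosPart H) where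
  nonempty := nonempty_subtype.2 hH
  exists_common_divisor := exists_common_divisor
  exists_equalizer q k l hkl := by
    have hcast : (k : ℚ) = l := mul_right_cancel₀ q.2.2.ne' (congrArg Subtype.val hkl)
    rw [PNat.coe_injective (Nat.cast_injective hcast)]
    exact ⟨q, 1, one_smul _ q, rfl⟩

theorem mem_iff_exists_eq_mul {X : Type*} [MulAction ℕ+ X] (h : IsFlatAction ℕ+ X)
    {j : X ≃ PosPart H} (hj : ∀ (k : ℕ+) x, (j (k • x) : ℚ) = k * j x) {q : ℚ} :
    q ∈ H ↔ ∃ (x : X) (n : ℤ), q = n * j x := by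
  rw [← h.mem_closure_range_iff (j := fun x => (j x : ℚ)) hj]
  have hrange : Set.range (fun x => (j x : ℚ)) = Set.range ((↑) : PosPart H → ℚ) :=
    j.surjective.range_comp _
  rw [hrange, closure_range_coe]

end PosPart

theorem IsFlatAction.exists_equiv_posPart {X : Type*} [MulAction ℕ+ X] (h : IsFlatAction ℕ+ X)
    (x₀ : X) : ∃ (H : AddSubgroup ℚ) (j : X ≃ PosPart H),
      (∀ (k : ℕ+) x, (j (k • x) : ℚ) = k * j x) ∧ (j x₀ : ℚ) = 1 := by
  obtain ⟨j, hj, hpos, hone⟩ := h.exists_homogeneous x₀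
  refine ⟨AddSubgroup.closure (Set.range j), Equiv.ofBijective
    (fun x => ⟨j x, AddSubgroup.subset_closure (Set.mem_range_self x), hpos x⟩) ⟨?_, ?_⟩, hj, hone⟩
  · exact fun x y hxy => h.injective_of_homogeneous hj (fun x => (hpos x).ne')
      (congrArg Subtype.val hxy)
  · rintro ⟨_, hq, hq0⟩
    obtain ⟨x, n, rfl⟩ := (h.mem_closure_range_iff hj).1 hq
    have hn : 0 < n := Int.cast_pos.1 ((mul_pos_iff_of_pos_right (hpos x)).1 hq0)
    lift n to ℕ using hn.le
    exact ⟨n.toPNat (Int.natCast_pos.1 hn) • x, Subtype.ext (hj _ x)⟩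

/-! ### Subgroups of the rationals and finite adeles -/

open IsDedekindDomain
open scoped WithZero

theorem exists_valuation_eq_mulSingle {R K : Type*} [CommRing R] [IsDomain R]
    [IsPrincipalIdealRing R] [Field K] [Algebra R K] [IsFractionRing R K]
    [DecidableEq (HeightOneSpectrum R)] (w : HeightOneSpectrum R) {γ : ℤᵐ⁰} (hγ : γ ≠ 0) :
    ∃ x : Kˣ, ∀ v : HeightOneSpectrum R, v.valuation K x = (Pi.mulSingle w γ : _ → ℤᵐ⁰) v := by
  obtain ⟨g, hg⟩ := IsPrincipalIdealRing.principal w.asIdeal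
  have hg0 : g ≠ 0 := by
    rintro rfl
    exact w.ne_bot (hg.trans Ideal.span_zero)
  have hgK : algebraMap R K g ≠ 0 := by simpa using hg0
  refine ⟨Units.mk0 _ hgK ^ (-WithZero.log γ), fun v => ?_⟩
  rw [Units.val_zpow_eq_zpow_val, Units.val_mk0, map_zpow₀, v.valuation_of_algebraMap]
  obtain rfl | hvw := eq_or_ne v w
  · rw [v.intValuation_singleton hg0 hg, ← WithZero.exp_zsmul, smul_eq_mul, neg_mul_neg, mul_one,
      WithZero.exp_log hγ, Pi.mulSingle_eq_same]
  · have hgv : g ∉ v.asIdeal := fun hmem => hvw <| HeightOneSpectrum.ext <| Eq.symm <|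
      w.isMaximal.eq_of_le v.isPrime.ne_top <|
        hg.trans_le ((Ideal.span_singleton_le_iff_mem _).2 hmem)
    rw [v.intValuation_eq_one_iff.2 hgv, one_zpow, Pi.mulSingle_eq_of_ne hvw]

theorem exists_valuation_eq {R K : Type*} [CommRing R] [IsDomain R]
    [IsPrincipalIdealRing R] [Field K] [Algebra R K] [IsFractionRing R K]
    {γ : HeightOneSpectrum R → ℤᵐ⁰} (hγ0 : ∀ v, γ v ≠ 0) (hγ : γ.mulSupport.Finite) :
    ∃ x : Kˣ, ∀ v : HeightOneSpectrum R, v.valuation K x = γ v := by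
  classical
  choose x hx using fun w => exists_valuation_eq_mulSingle (K := K) w (hγ0 w)
  refine ⟨∏ w ∈ hγ.toFinset, x w, fun v => ?_⟩
  rw [Units.coe_prod, map_prod, Finset.prod_congr rfl fun w _ => hx w v,
    Finset.prod_pi_mulSingle, ite_eq_left_iff, hγ.mem_toFinset, Function.notMem_mulSupport]
  exact Eq.symm

theorem exists_pos_rat_valuation_eq {γ : HeightOneSpectrum ℤ → ℤᵐ⁰} (hγ0 : ∀ v, γ v ≠ 0)
    (hγ : γ.mulSupport.Finite) :
    ∃ q : ℚ, 0 < q ∧ ∀ v : HeightOneSpectrum ℤ, v.valuation ℚ q = γ v := by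
  obtain ⟨x, hx⟩ := exists_valuation_eq (K := ℚ) hγ0 hγ
  refine ⟨|x|, abs_pos.2 x.ne_zero, fun v => ?_⟩
  obtain h | h := abs_choice (x : ℚ)
  · rw [h, hx]
  · rw [h, Valuation.map_neg, hx]

theorem exists_ne_zero_smul_mem {R K : Type*} [CommRing R] [Field K] [Algebra R K]
    [IsFractionRing R K] {N : Submodule R K} (hN : N ≠ ⊥) (x : K) : ∃ r : R, r ≠ 0 ∧ r • x ∈ N := by
  have : IsDomain R := (IsFractionRing.injective R K).isDomain (algebraMap R K)
  obtain rfl | hx := eq_or_ne x 0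
  · exact ⟨1, one_ne_zero, by rw [smul_zero]; exact N.zero_mem⟩
  obtain ⟨y, hy, hy0⟩ := N.exists_mem_ne_zero_of_ne_bot hN
  obtain ⟨r, s, hs, hrs⟩ := IsFractionRing.div_surjective (A := R) (y / x)
  have hs0 : algebraMap R K s ≠ 0 := IsFractionRing.to_map_ne_zero_of_mem_nonZeroDivisors hs
  refine ⟨r, ?_, ?_⟩
  · rintro rfl
    rw [map_zero, zero_div, eq_comm, div_eq_zero_iff] at hrs
    exact hrs.elim hy0 hx
  · have hrx : r • x = s • y := by
      rw [Algebra.smul_def, Algebra.smul_def, mul_comm (algebraMap R K s)]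
      exact (div_eq_div_iff hs0 hx).1 hrs
    rw [hrx]
    exact N.smul_mem s hy

theorem mem_of_forall_exists_valuation_le {R K : Type*} [CommRing R] [IsDedekindDomain R] [Field K]
    [Algebra R K] [IsFractionRing R K] {N : Submodule R K} (hN : N ≠ ⊥) {x : K}
    (hx : ∀ v : HeightOneSpectrum R, ∃ y ∈ N, v.valuation K x ≤ v.valuation K y) : x ∈ N := by
  obtain rfl | hx0 := eq_or_ne x 0
  · exact N.zero_mem
  suffices N.colon {x} = ⊤ by
    rw [← one_smul R x, ← Submodule.mem_colon_singleton, this]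
    exact Submodule.mem_top
  by_contra hcolon
  obtain ⟨m, hm, hle⟩ := Ideal.exists_le_maximal _ hcolon
  have hm0 : m ≠ ⊥ := by
    rintro rfl
    obtain ⟨r, hr0, hr⟩ := exists_ne_zero_smul_mem hN x
    exact hr0 (Ideal.mem_bot.1 (hle (Submodule.mem_colon_singleton.2 hr)))
  let v : HeightOneSpectrum R := ⟨m, hm.isPrime, hm0⟩
  obtain ⟨y, hy, hxy⟩ := hx v
  have hvx : v.valuation K x ≠ 0 := (map_ne_zero _).2 hx0
  have hy0 : y ≠ 0 := (map_ne_zero _).1 (ne_of_gt ((zero_lt_iff.2 hvx).trans_le hxy))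
  obtain ⟨n, ⟨d, hd⟩, hnd⟩ := v.exists_primeCompl_mul_eq_of_integer (x / y) <| by
    rw [map_div₀]
    exact div_le_one_of_le₀ hxy zero_le
  have hdx : d • x = n • y := by
    rw [Algebra.smul_def, Algebra.smul_def, ← hnd]
    field_simp
  refine hd (hle ?_)
  rw [Submodule.mem_colon_singleton, hdx]
  exact N.smul_mem n hy

theorem exists_isGreatest_of_bddAbove {S : Set ℤᵐ⁰} (hS : S.Nonempty) (hbdd : BddAbove S) :
    ∃ γ, IsGreatest S γ := by
  by_cases hS0 : ∀ γ ∈ S, γ = 0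
  · obtain ⟨γ, hγ⟩ := hS
    exact ⟨γ, hγ, fun δ hδ => (hS0 δ hδ).trans_le zero_le⟩
  push Not at hS0
  obtain ⟨γ, hγ, hγ0⟩ := hS0
  obtain ⟨δ, hδ⟩ := hbdd
  have hlog : BddAbove {n : ℤ | WithZero.exp n ∈ S} := by
    refine ⟨WithZero.log δ, fun n hn => ?_⟩
    exact WithZero.le_log_of_exp_le (hδ hn)
  obtain ⟨n, hn, hmax⟩ := hlog.exists_isGreatest_of_nonempty
    ⟨WithZero.log γ, by rwa [Set.mem_ofPred_eq, WithZero.exp_log hγ0]⟩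
  refine ⟨WithZero.exp n, hn, fun ε hε => ?_⟩
  obtain rfl | hε0 := eq_or_ne ε 0
  · exact zero_le
  · refine (WithZero.log_le_iff_le_exp hε0).1 (hmax ?_)
    rwa [Set.mem_ofPred_eq, WithZero.exp_log hε0]

theorem exists_mul_le_one_iff {S : Set ℤᵐ⁰} (hS : 1 ∈ S) :
    ∃ γ ≤ 1, ∀ t, γ * t ≤ 1 ↔ ∃ s ∈ S, t ≤ s := by
  by_cases hbdd : BddAbove S
  · obtain ⟨γ, hγ, hmax⟩ := exists_isGreatest_of_bddAbove ⟨1, hS⟩ hbdd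
    refine ⟨γ⁻¹, inv_le_one_of_one_le₀ (hmax hS), fun t => ?_⟩
    rw [inv_mul_le_one₀ (zero_lt_one.trans_le (hmax hS))]
    exact ⟨fun ht => ⟨γ, hγ, ht⟩, fun ⟨s, hs, hts⟩ => hts.trans (hmax hs)⟩
  · refine ⟨0, zero_le, fun t => ?_⟩
    obtain ⟨s, hs, hts⟩ := not_bddAbove_iff.1 hbdd t
    rw [zero_mul, iff_true_left zero_le]
    exact ⟨s, hs, hts.le⟩

/-- The finite adele with given integral local components. -/
def FinAdele.ofIntegral (x : ∀ v : HeightOneSpectrum ℤ, v.adicCompletion ℚ)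
    (hx : ∀ v, Valued.v (x v) ≤ 1) : FinAdele :=
  ⟨x, .of_forall hx⟩

theorem FinAdele.ofIntegral_apply (x : ∀ v : HeightOneSpectrum ℤ, v.adicCompletion ℚ)
    (hx : ∀ v, Valued.v (x v) ≤ 1) (v : HeightOneSpectrum ℤ) : ofIntegral x hx v = x v :=
  rfl

theorem FinAdele.mul_apply (a b : FinAdele) (v : HeightOneSpectrum ℤ) : (a * b) v = a v * b v :=
  rfl

theorem valued_algebraMap (q : ℚ) (v : HeightOneSpectrum ℤ) :
    Valued.v (algebraMap ℚ FinAdele q v) = v.valuation ℚ q :=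
  HeightOneSpectrum.valuedAdicCompletion_eq_valuation' v q

theorem mem_subgroupOf {a : FinAdele} {q : ℚ} :
    q ∈ subgroupOf a ↔ ∀ v : HeightOneSpectrum ℤ, Valued.v (a v) * v.valuation ℚ q ≤ 1 := by
  refine forall_congr' fun v => ?_
  rw [← valued_algebraMap, ← map_mul, ← FinAdele.mul_apply]
  exact HeightOneSpectrum.mem_adicCompletionIntegers ℤ ℚ v

theorem exists_subgroupOf_eq {H : AddSubgroup ℚ} (hH : 1 ∈ H) :
    ∃ a : FinAdele, subgroupOf a = H := by
  choose γ hγ1 hγ using fun v : HeightOneSpectrum ℤ =>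
    exists_mul_le_one_iff (S := v.valuation ℚ '' H) ⟨1, hH, map_one _⟩
  choose x hx using fun v : HeightOneSpectrum ℤ =>
    v.valuedAdicCompletion_surjective (K := ℚ) (γ v)
  refine ⟨.ofIntegral x fun v => (hx v).trans_le (hγ1 v), ?_⟩
  have hbot : AddSubgroup.toIntSubmodule H ≠ ⊥ :=
    Submodule.ne_bot_iff _ |>.2 ⟨1, hH, one_ne_zero⟩
  ext q
  simp only [mem_subgroupOf, FinAdele.ofIntegral_apply, hx, hγ, Set.exists_mem_image,
    SetLike.mem_coe]
  exact ⟨mem_of_forall_exists_valuation_le hbot, fun hq v => ⟨q, hq, le_rfl⟩⟩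

theorem exists_pos_mem_subgroupOf (a : FinAdele) : ∃ q ∈ subgroupOf a, 0 < q := by
  have hne (v) : max 1 (Valued.v (a v)) ≠ 0 := (zero_lt_one.trans_le (le_max_left _ _)).ne'
  have hfin : (fun v => (max 1 (Valued.v (a v)))⁻¹).mulSupport.Finite := by
    rw [Function.mulSupport_fun_inv]
    refine (Filter.eventually_cofinite.1 a.2).subset fun v hv hmem => hv ?_
    exact max_eq_left hmem
  obtain ⟨q, hq0, hq⟩ := exists_pos_rat_valuation_eq (fun v => inv_ne_zero (hne v)) hfin
  refine ⟨q, mem_subgroupOf.2 fun v => ?_, hq0⟩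
  rw [hq]
  exact mul_inv_le_one_of_le₀ (le_max_right _ _) zero_le

theorem exists_mem_subgroupOf_valuation_eq (a : FinAdele) (v : HeightOneSpectrum ℤ) {γ : ℤᵐ⁰}
    (hγ0 : γ ≠ 0) (hγ : Valued.v (a v) * γ ≤ 1) : ∃ q ∈ subgroupOf a, v.valuation ℚ q = γ := by
  classical
  obtain ⟨q, hq, hq0⟩ := exists_pos_mem_subgroupOf a
  have hvq : v.valuation ℚ q ≠ 0 := (map_ne_zero _).2 hq0.ne'
  obtain ⟨x, hx⟩ := exists_valuation_eq_mulSingle (K := ℚ) v (div_ne_zero hγ0 hvq)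
  have hγx : v.valuation ℚ (x * q) = γ := by
    rw [map_mul, hx, Pi.mulSingle_eq_same, div_mul_cancel₀ _ hvq]
  refine ⟨x * q, mem_subgroupOf.2 fun w => ?_, hγx⟩
  obtain rfl | hwv := eq_or_ne w v
  · rwa [hγx]
  · rw [map_mul, hx, Pi.mulSingle_eq_of_ne hwv, one_mul]
    exact mem_subgroupOf.1 hq w

theorem valued_le_of_subgroupOf_le {a b : FinAdele} (h : subgroupOf a ≤ subgroupOf b)
    (v : HeightOneSpectrum ℤ) : Valued.v (b v) ≤ Valued.v (a v) := by
  by_contra! hlt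
  have hb : Valued.v (b v) ≠ 0 := (zero_le.trans_lt hlt).ne'
  have hmul : Valued.v (a v) * ((Valued.v (b v))⁻¹ * WithZero.exp 1) ≤ 1 := by
    rw [← mul_assoc, ← WithZero.lt_mul_exp_iff_le one_ne_zero, one_mul]
    refine mul_lt_of_lt_one_left WithZero.exp_pos ?_
    rw [← div_eq_mul_inv]
    exact (div_lt_one₀ (zero_lt_iff.2 hb)).2 hlt
  obtain ⟨q, hq, hvq⟩ := exists_mem_subgroupOf_valuation_eq a v
    (mul_ne_zero (inv_ne_zero hb) WithZero.exp_ne_zero) hmul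
  have hbq := mem_subgroupOf.1 (h hq) v
  rw [hvq, mul_inv_cancel_left₀ hb, ← WithZero.exp_zero, WithZero.exp_le_exp] at hbq
  exact absurd hbq (by decide)

theorem subgroupOf_eq_subgroupOf_iff {a b : FinAdele} :
    subgroupOf a = subgroupOf b ↔ ∀ v, Valued.v (a v) = Valued.v (b v) := by
  refine ⟨fun h v => ?_, fun h => ?_⟩
  · exact (valued_le_of_subgroupOf_le h.ge v).antisymm (valued_le_of_subgroupOf_le h.le v)
  · ext q
    simp only [mem_subgroupOf, h]

theorem exists_zHatUnit_eq_iff {a : FinAdele} :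
    (∃ u : zHatˣ, (u : FinAdele) = a) ↔ ∀ v, Valued.v (a v) = 1 := by
  constructor
  · rintro ⟨u, rfl⟩ v
    have hmul : Valued.v ((u : FinAdele) v) * Valued.v ((↑u⁻¹ : zHat).1 v) = 1 := by
      have hinv : (u : FinAdele) * (↑u⁻¹ : zHat).1 = 1 := congrArg Subtype.val u.mul_inv
      rw [← map_mul, ← FinAdele.mul_apply, hinv]
      exact map_one _
    exact eq_one_of_one_le_mul_left ((u : zHat).2 v) ((↑u⁻¹ : zHat).2 v) hmul.ge
  · intro ha
    have ha' (v) : Valued.v (a v)⁻¹ = 1 := by rw [map_inv₀, ha, inv_one]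
    let b : FinAdele := .ofIntegral (fun v => (a v)⁻¹) fun v => (ha' v).le
    have hab : a * b = 1 := FiniteAdeleRing.ext _ fun v => mul_inv_cancel₀ <|
      (map_ne_zero _).1 ((ha v).trans_ne one_ne_zero)
    exact ⟨⟨⟨a, fun v => (ha v).le⟩, ⟨b, fun v => (ha' v).le⟩, Subtype.ext hab,
      Subtype.ext ((mul_comm b a).trans hab)⟩, rfl⟩

theorem exists_zHatUnit_mul_eq_iff {a b : FinAdele} :
    (∃ u : zHatˣ, (u : FinAdele) * a = b) ↔ subgroupOf b = subgroupOf a := by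
  rw [subgroupOf_eq_subgroupOf_iff]
  constructor
  · rintro ⟨u, rfl⟩ v
    rw [FinAdele.mul_apply, map_mul, exists_zHatUnit_eq_iff.1 ⟨u, rfl⟩, one_mul]
  · intro h
    classical
    let x (v : HeightOneSpectrum ℤ) : v.adicCompletion ℚ := if a v = 0 then 1 else b v / a v
    have hx (v) : Valued.v (x v) = 1 := by
      by_cases ha : a v = 0
      · rw [show x v = 1 from if_pos ha, map_one]
      · rw [show x v = _ from if_neg ha, map_div₀, h, div_self ((map_ne_zero _).2 ha)]
    obtain ⟨u, hu⟩ := (exists_zHatUnit_eq_iff (a := .ofIntegral x fun v => (hx v).le)).2 hx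
    refine ⟨u, FiniteAdeleRing.ext _ fun v => ?_⟩
    rw [FinAdele.mul_apply, hu, FinAdele.ofIntegral_apply]
    by_cases ha : a v = 0
    · rw [ha, mul_zero, eq_comm, ← map_eq_zero (Valued.v (R := v.adicCompletion ℚ)), h, ha,
        map_zero]
    · rw [show x v = _ from if_neg ha, div_mul_cancel₀ _ ha]

theorem mem_subgroupOf_algebraMap_mul {a : FinAdele} {q r : ℚ} :
    r ∈ subgroupOf (algebraMap ℚ FinAdele q * a) ↔ q * r ∈ subgroupOf a := by
  simp only [mem_subgroupOf, FinAdele.mul_apply, map_mul, valued_algebraMap, mul_assoc,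
    mul_left_comm]

theorem exists_mem_subgroupOf_units_iff (a : FinAdeleˣ) :
    ∃ c : ℚ, 0 < c ∧ ∀ q, q ∈ subgroupOf a ↔ c * q ∈ subgroupOf 1 := by
  obtain ⟨hne, hfin⟩ := FiniteAdeleRing.isUnit_iff.1 a.isUnit
  obtain ⟨c, hc0, hc⟩ := exists_pos_rat_valuation_eq
    (fun v => (map_ne_zero (Valued.v (R := v.adicCompletion ℚ))).2 (hne v)) hfin
  have hone (v : HeightOneSpectrum ℤ) : Valued.v ((1 : FinAdele) v) = 1 := map_one _
  refine ⟨c, hc0, fun q => ?_⟩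
  simp only [mem_subgroupOf, map_mul, hc, hone, one_mul]

/-! ### Adele classes -/

namespace Adele

theorem ext_components {α β : Adele} (hreal : α.real = β.real) (hfin : α.fin = β.fin) : α = β :=
  Prod.ext (realEquiv.injective hreal) hfin

theorem real_mk (r : ℝ) (a : FinAdele) : (mk r a).real = r := realEquiv.apply_symm_apply r

theorem real_mul (α β : Adele) : (α * β).real = α.real * β.real := map_mul realEquiv α.1 β.1

theorem fin_mul (α β : Adele) : (α * β).fin = α.fin * β.fin := rfl

theorem real_zHatUnits (u : zHatˣ) : (zHatUnits u : Adele).real = 1 := real_mk 1 _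

theorem fin_zHatUnits (u : zHatˣ) : (zHatUnits u : Adele).fin = (u : FinAdele) := rfl

theorem real_posReal (t : {t : ℝ // 0 < t}) : (posReal t : Adele).real = t := real_mk _ _

theorem real_principal (q : ℚˣ) : (principal q : Adele).real = ((q : ℚ) : ℝ) :=
  eq_ratCast ((realEquiv : NumberField.InfiniteAdeleRing ℚ →+* ℝ).comp
    ((RingHom.fst (NumberField.InfiniteAdeleRing ℚ) FinAdele).comp (algebraMap ℚ Adele))) (q : ℚ)

theorem fin_principal (q : ℚˣ) : (principal q : Adele).fin = algebraMap ℚ FinAdele q := rfl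

theorem real_posReal_smul (t : {t : ℝ // 0 < t}) (α : Adele) :
    (posReal t • α).real = t * α.real := by
  rw [Units.smul_def, smul_eq_mul, real_mul, real_posReal]

theorem fin_posReal_smul (t : {t : ℝ // 0 < t}) (α : Adele) : (posReal t • α).fin = α.fin :=
  one_mul α.fin

theorem real_units_ne_zero (g : Adeleˣ) : (g : Adele).real ≠ 0 :=
  ((Prod.isUnit_iff.1 g.isUnit).1.map realEquiv).ne_zero

theorem equiv_iff {α β : Adele} : α ≈ β ↔ ∃ q : ℚˣ, (q : ℚ) * α.real = β.real ∧
    ∀ r, r ∈ subgroupOf β.fin ↔ q * r ∈ subgroupOf α.fin := by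
  have hsmul (u : zHatˣ) (q : ℚˣ) : (zHatUnits u * principal q : Adeleˣ) • α = β ↔
      (q : ℚ) * α.real = β.real ∧ (u : FinAdele) * (algebraMap ℚ FinAdele q * α.fin) = β.fin := by
    have hreal : ((zHatUnits u * principal q : Adeleˣ) • α).real = (q : ℚ) * α.real := by
      rw [Units.smul_def, smul_eq_mul, Units.val_mul, real_mul, real_mul, real_zHatUnits,
        real_principal, one_mul]
    have hfin : ((zHatUnits u * principal q : Adeleˣ) • α).fin =
        (u : FinAdele) * (algebraMap ℚ FinAdele q * α.fin) := by
      rw [Units.smul_def, smul_eq_mul, Units.val_mul, fin_mul, fin_mul, fin_zHatUnits,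
        fin_principal, mul_assoc]
    rw [← hreal, ← hfin]
    exact ⟨fun h => h ▸ ⟨rfl, rfl⟩, fun h => ext_components h.1 h.2⟩
  calc α ≈ β ↔ ∃ (u : zHatˣ) (q : ℚˣ), (zHatUnits u * principal q : Adeleˣ) • α = β := Iff.rfl
    _ ↔ ∃ q : ℚˣ, (q : ℚ) * α.real = β.real ∧
          ∃ u : zHatˣ, (u : FinAdele) * (algebraMap ℚ FinAdele q * α.fin) = β.fin := by
        simp only [hsmul, exists_and_left, exists_comm (α := zHatˣ)]
    _ ↔ _ := by
        simp only [exists_zHatUnit_mul_eq_iff, AddSubgroup.ext_iff, mem_subgroupOf_algebraMap_mul]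

theorem equiv_iff_exists_pos {α β : Adele} : α ≈ β ↔ ∃ c : ℚ, 0 < c ∧ |β.real| = c * |α.real| ∧
    ∀ r, r ∈ subgroupOf β.fin ↔ c * r ∈ subgroupOf α.fin := by
  rw [equiv_iff]
  constructor
  · rintro ⟨q, hreal, hfin⟩
    refine ⟨|q|, abs_pos.2 q.ne_zero, ?_, fun r => ?_⟩
    · rw [← hreal, abs_mul, Rat.cast_abs]
    · rw [hfin, ← abs_mem_iff, abs_mul, ← abs_mem_iff (x := |(q : ℚ)| * r), abs_mul, abs_abs]
  · rintro ⟨c, hc, hreal, hfin⟩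
    rw [← abs_of_pos (Rat.cast_pos.2 hc : (0 : ℝ) < c), ← abs_mul] at hreal
    obtain h | h := abs_eq_abs.1 hreal
    · exact ⟨Units.mk0 c hc.ne', h.symm, hfin⟩
    · refine ⟨-Units.mk0 c hc.ne', ?_, fun r => ?_⟩
      · rw [h, Units.val_neg, Units.val_mk0, Rat.cast_neg, neg_mul]
      · rw [hfin, Units.val_neg, Units.val_mk0, neg_mul, neg_mem_iff]

theorem exists_posReal_equiv (g : Adeleˣ) :
    ∃ t : {t : ℝ // 0 < t}, (posReal t : Adele) ≈ (g : Adele) := by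
  obtain ⟨c, hc, hmem⟩ := exists_mem_subgroupOf_units_iff (Prod.isUnit_iff.1 g.isUnit).2.unit
  have hcR : (0 : ℝ) < c := Rat.cast_pos.2 hc
  refine ⟨⟨|(g : Adele).real| / c, div_pos (abs_pos.2 (real_units_ne_zero g)) hcR⟩, ?_⟩
  refine equiv_iff_exists_pos.2 ⟨c, hc, ?_, hmem⟩
  rw [real_posReal, abs_div, abs_abs, abs_of_pos hcR, mul_div_cancel₀ _ hcR.ne']

end Adele

theorem exists_ideleClass_eq_mk (γ : IdeleClass) : ∃ (u : zHatˣ) (t : {t : ℝ // 0 < t}),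
    γ = QuotientGroup.mk (zHatUnits u * posReal t) := by
  obtain ⟨g, rfl⟩ := QuotientGroup.mk_surjective γ
  obtain ⟨t, u, q, h⟩ := Adele.exists_posReal_equiv g
  obtain rfl : zHatUnits u * principal q * posReal t = g := Units.ext h
  refine ⟨u, t, QuotientGroup.eq.2 ⟨q⁻¹, ?_⟩⟩
  rw [map_inv, eq_inv_mul_iff_mul_eq, mul_right_comm, mul_inv_cancel_right]

theorem ideleClass_mk_smul_adeleClass (u : zHatˣ) (g : Adeleˣ) (α : Adele) :
    (QuotientGroup.mk (zHatUnits u * g) : IdeleClass) • adeleClass α = adeleClass (g • α) := by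
  refine Eq.symm (Quotient.sound ⟨u, 1, ?_⟩)
  rw [map_one, mul_one, mul_smul]

/-! ### The correspondence between points and adele classes -/

theorem Adele.forall_equiv_posReal_smul_iff {α : Adele} :
    (∀ t, α ≈ posReal t • α) ↔ α.real = 0 := by
  constructor
  · intro h
    obtain ⟨q, hreal, -⟩ := equiv_iff.1 (h ⟨√2, Real.sqrt_pos.2 two_pos⟩)
    rw [real_posReal_smul] at hreal
    by_contra h0
    exact irrational_sqrt_two.ne_rat q (mul_right_cancel₀ h0 hreal).symm
  · intro h t
    have hfix : posReal t • α = α :=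
      ext_components (by rw [real_posReal_smul, h, mul_zero]) (fin_posReal_smul t α)
    rw [hfix]

theorem isAttached_iff {P : RMaxPoint structureSheaf} {α : Adele} :
    IsAttached P α ↔ ∃ j : flatSet P.point ≃ PosPart (subgroupOf α.fin),
      (∀ (k : ℕ+) x, (j (k • x) : ℚ) = k * j x) ∧ ∀ x, P.logValue x = |α.real| * (j x : ℚ) := by
  simp only [RMaxPoint.logValue_eq_iff, RMax.eq_exp_iff]
  rfl

theorem exists_isAttached (P : RMaxPoint structureSheaf) : ∃ α, IsAttached P α := by
  have hflat := isFlatAction_flatMulAction P.point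
  obtain ⟨x₀⟩ := hflat.nonempty
  obtain ⟨H, j, hj, hone⟩ := hflat.exists_equiv_posPart x₀
  obtain ⟨a, rfl⟩ := exists_subgroupOf_eq (hone ▸ (j x₀).2.1)
  refine ⟨Adele.mk (P.logValue x₀) a, isAttached_iff.2 ⟨j, hj, fun x => ?_⟩⟩
  have hprop := hflat.mul_comm_of_homogeneous P.logValue_smul (j := fun x => ((j x : ℚ) : ℝ))
    (fun k x => by rw [hj]; push_cast; rfl) x x₀
  rw [hone, Rat.cast_one, mul_one] at hprop
  rw [Adele.real_mk, abs_of_nonneg (P.logValue_nonneg x₀)]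
  exact hprop

theorem exists_point_isAttached (α : Adele) : ∃ P, IsAttached P α := by
  obtain ⟨p, j, hj⟩ := (PosPart.isFlatAction (exists_pos_mem_subgroupOf α.fin)).exists_point
  replace hj (k : ℕ+) (x : flatSet p) : (j (k • x) : ℚ) = k * j x := by rw [hj, PosPart.coe_smul]
  obtain ⟨f, hf⟩ := RMaxPoint.exists_logValue_eq (p := p) (c := fun x => |α.real| * (j x : ℚ))
    (fun k x => by rw [hj]; push_cast; ring)
    fun x => mul_nonneg (abs_nonneg _) (Rat.cast_nonneg.2 (j x).2.2.le)
  exact ⟨⟨p, f⟩, isAttached_iff.2 ⟨j, hj, congrFun hf⟩⟩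

/-- Division by `c > 0`, as a bijection between the positive parts of two subgroups of `ℚ`. -/
def PosPart.divEquiv {H K : AddSubgroup ℚ} {c : ℚ} (hc : 0 < c) (h : ∀ q, q ∈ K ↔ c * q ∈ H) :
    PosPart H ≃ PosPart K where
  toFun q := ⟨q / c, by rw [h, mul_div_cancel₀ _ hc.ne']; exact q.2.1, div_pos q.2.2 hc⟩
  invFun q := ⟨c * q, (h _).1 q.2.1, mul_pos hc q.2.2⟩
  left_inv q := Subtype.ext (mul_div_cancel₀ _ hc.ne')
  right_inv q := Subtype.ext (mul_div_cancel_left₀ _ hc.ne')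

namespace IsAttached

variable {P Q : RMaxPoint structureSheaf} {α β : Adele}

theorem of_adele_equiv (h : IsAttached P α) (hαβ : α ≈ β) : IsAttached P β := by
  obtain ⟨j, hj, hlog⟩ := isAttached_iff.1 h
  obtain ⟨c, hc, hreal, hmem⟩ := Adele.equiv_iff_exists_pos.1 hαβ
  have hcR : (c : ℝ) ≠ 0 := Rat.cast_ne_zero.2 hc.ne'
  have hval (x : flatSet P.point) : (j.trans (PosPart.divEquiv hc hmem) x : ℚ) = j x / c := rfl
  refine isAttached_iff.2 ⟨j.trans (PosPart.divEquiv hc hmem), fun k x => ?_, fun x => ?_⟩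
  · rw [hval, hval, hj, mul_div_assoc]
  · rw [hval, hlog, hreal, Rat.cast_div, mul_comm (c : ℝ), mul_assoc, mul_div_cancel₀ _ hcR]

theorem adele_equiv (hα : IsAttached P α) (hβ : IsAttached P β) : α ≈ β := by
  obtain ⟨i, hi, hlog⟩ := isAttached_iff.1 hα
  obtain ⟨j, hj, hlog'⟩ := isAttached_iff.1 hβ
  have hflat := isFlatAction_flatMulAction P.point
  obtain ⟨x₀⟩ := hflat.nonempty
  obtain ⟨c, hc, hij⟩ : ∃ c : ℚ, 0 < c ∧ ∀ x, (i x : ℚ) = c * j x := by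
    refine ⟨i x₀ / j x₀, div_pos (i x₀).2.2 (j x₀).2.2, fun x => ?_⟩
    rw [div_mul_eq_mul_div, eq_div_iff (j x₀).2.2.ne']
    exact hflat.mul_comm_of_homogeneous (i := fun x => (i x : ℚ)) (j := fun x => (j x : ℚ))
      hi hj x x₀
  refine Adele.equiv_iff_exists_pos.2 ⟨c, hc, ?_, fun q => ?_⟩
  · refine mul_right_cancel₀ (Rat.cast_ne_zero.2 (j x₀).2.2.ne' : ((j x₀ : ℚ) : ℝ) ≠ 0) ?_
    rw [← hlog', hlog, hij, Rat.cast_mul]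
    ring
  · simp only [PosPart.mem_iff_exists_eq_mul hflat hi, PosPart.mem_iff_exists_eq_mul hflat hj, hij,
      mul_left_comm _ c, mul_right_inj' hc.ne']

theorem of_equiv (h : IsAttached P α) (hPQ : P ≈ Q) : IsAttached Q α := by
  obtain ⟨j, hj, hlog⟩ := isAttached_iff.1 h
  obtain ⟨e, he, hlog'⟩ := RMaxPoint.equiv_iff.1 hPQ
  refine isAttached_iff.2 ⟨e.symm.trans j, fun k => e.surjective.forall.2 fun x => ?_,
    e.surjective.forall.2 fun x => ?_⟩
  · rw [← he, Equiv.trans_apply, Equiv.trans_apply, e.symm_apply_apply, e.symm_apply_apply, hj]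
  · rw [hlog', hlog, Equiv.trans_apply, e.symm_apply_apply]

theorem equiv (hP : IsAttached P α) (hQ : IsAttached Q α) : P ≈ Q := by
  obtain ⟨i, hi, hlog⟩ := isAttached_iff.1 hP
  obtain ⟨j, hj, hlog'⟩ := isAttached_iff.1 hQ
  refine RMaxPoint.equiv_iff.2
    ⟨i.trans j.symm, fun k x => j.injective (Subtype.ext ?_), fun x => ?_⟩
  · simp only [Equiv.trans_apply, Equiv.apply_symm_apply, hi, hj]
  · simp only [Equiv.trans_apply, Equiv.apply_symm_apply, hlog, hlog']

theorem equiv_iff (h : IsAttached P α) : P ≈ Q ↔ IsAttached Q α := ⟨h.of_equiv, h.equiv⟩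

theorem adele_equiv_iff (h : IsAttached P α) : α ≈ β ↔ IsAttached P β :=
  ⟨h.of_adele_equiv, h.adele_equiv⟩

theorem frob (h : IsAttached P α) (t : {t : ℝ // 0 < t}) :
    IsAttached (P.frob t) (posReal t • α) := by
  obtain ⟨j, hj, hlog⟩ := isAttached_iff.1 h
  rw [isAttached_iff, Adele.fin_posReal_smul, Adele.real_posReal_smul, abs_mul, abs_of_pos t.2]
  have hmul (x : flatSet P.point) : t * P.logValue x = t * |α.real| * (j x : ℚ) := by
    rw [hlog, mul_assoc]
  exact ⟨j, hj, fun x => (P.logValue_frob t x).trans (hmul x)⟩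

theorem logRange_eq (h : IsAttached P α) :
    P.logRange = {y : ℝ | ∃ q ∈ subgroupOf α.fin, y = |α.real| * (q : ℝ)} := by
  obtain ⟨j, hj, hlog⟩ := isAttached_iff.1 h
  ext y
  simp only [P.logRange_eq, hlog,
    PosPart.mem_iff_exists_eq_mul (isFlatAction_flatMulAction P.point) hj, Set.mem_ofPred_eq]
  constructor
  · rintro ⟨x, n, rfl⟩
    exact ⟨n * j x, ⟨x, n, rfl⟩, by push_cast; ring⟩
  · rintro ⟨_, ⟨x, n, rfl⟩, rfl⟩
    exact ⟨x, n, by push_cast; ring⟩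

theorem isDegenerate_iff (h : IsAttached P α) : P.IsDegenerate ↔ α.real = 0 := by
  obtain ⟨j, -, hlog⟩ := isAttached_iff.1 h
  have hne (x : flatSet P.point) : ((j x : ℚ) : ℝ) ≠ 0 := Rat.cast_ne_zero.2 (j x).2.2.ne'
  have : Nonempty (flatSet P.point) := (isFlatAction_flatMulAction P.point).nonempty
  simp only [P.isDegenerate_iff, hlog, mul_eq_zero, abs_eq_zero, hne, or_false, forall_const]

end IsAttached

theorem RMaxPoint.isDegenerate_iff_forall_frob_equiv {P : RMaxPoint structureSheaf} :
    P.IsDegenerate ↔ ∀ t, P.frob t ≈ P := by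
  obtain ⟨α, h⟩ := exists_isAttached P
  calc P.IsDegenerate ↔ α.real = 0 := h.isDegenerate_iff
    _ ↔ ∀ t, α ≈ posReal t • α := Adele.forall_equiv_posReal_smul_iff.symm
    _ ↔ ∀ t, IsAttached P (posReal t • α) := forall_congr' fun _ => h.adele_equiv_iff
    _ ↔ ∀ t, P.frob t ≈ P := forall_congr' fun t => (h.frob t).equiv_iff.symm

namespace RMaxPoint

/-- An adele to which a point is attached; only its class is determined by the point. -/
def adele (P : RMaxPoint structureSheaf) : Adele := (exists_isAttached P).choose

theorem isAttached_adele (P : RMaxPoint structureSheaf) : IsAttached P P.adele :=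
  (exists_isAttached P).choose_spec

end RMaxPoint

/-- The bijection from the classes of points over `RMax` to the classes of adeles, which maps a
point to the class of the adeles to which it is attached. -/
def pointsEquiv : RMaxPoints structureSheaf ≃ AdeleClassQuotient :=
  Equiv.ofBijective
    (Quotient.map RMaxPoint.adele fun P Q h =>
      (P.isAttached_adele.of_equiv h).adele_equiv Q.isAttached_adele) <| by
    refine ⟨?_, ?_⟩
    · rintro ⟨P⟩ ⟨Q⟩ h
      refine Quotient.sound (IsAttached.equiv ?_ Q.isAttached_adele)
      exact P.isAttached_adele.of_adele_equiv (Quotient.exact h)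
    · rintro ⟨α⟩
      obtain ⟨P, hP⟩ := exists_point_isAttached α
      exact ⟨Quotient.mk _ P, Quotient.sound (P.isAttached_adele.adele_equiv hP)⟩

theorem pointsEquiv_mk_eq_iff {P : RMaxPoint structureSheaf} {α : Adele} :
    pointsEquiv (Quotient.mk _ P) = adeleClass α ↔ IsAttached P α :=
  Quotient.eq.trans P.isAttached_adele.adele_equiv_iff

theorem pointsEquiv_frob (u : zHatˣ) (t : {t : ℝ // 0 < t}) (x : RMaxPoints structureSheaf) :
    pointsEquiv (x.frob t) =
      (QuotientGroup.mk (zHatUnits u * posReal t) : IdeleClass) • pointsEquiv x := by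
  induction x using Quotient.inductionOn with | h P => ?_
  rw [pointsEquiv_mk_eq_iff.2 P.isAttached_adele]
  refine Eq.trans ?_ (ideleClass_mk_smul_adeleClass u (posReal t) P.adele).symm
  exact pointsEquiv_mk_eq_iff.2 (P.isAttached_adele.frob t)

theorem isDegenerate_iff_exists_pointsEquiv_eq {P : RMaxPoint structureSheaf} :
    P.IsDegenerate ↔
      ∃ a : FinAdele, pointsEquiv (Quotient.mk _ P) = adeleClass (Adele.mk 0 a) := by
  simp only [pointsEquiv_mk_eq_iff]
  constructor
  · intro h
    have hadele : P.adele = Adele.mk 0 P.adele.fin := Adele.ext_components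
      ((P.isAttached_adele.isDegenerate_iff.1 h).trans (Adele.real_mk 0 _).symm) rfl
    exact ⟨P.adele.fin, hadele ▸ P.isAttached_adele⟩
  · rintro ⟨a, ha⟩
    exact ha.isDegenerate_iff.2 (Adele.real_mk 0 a)

theorem isDegenerate_iff_forall_frob_mk_eq {P : RMaxPoint structureSheaf} :
    P.IsDegenerate ↔ ∀ t : {t : ℝ // 0 < t},
      RMaxPoints.frob t (Quotient.mk _ P) = Quotient.mk _ P :=
  RMaxPoint.isDegenerate_iff_forall_frob_equiv.trans (forall_congr' fun _ => Quotient.eq.symm)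

end ArithSite

end

open ArithSite in
theorem theorem3p5 :
    ∃ Θ : RMaxPoints structureSheaf ≃ AdeleClassQuotient,
      -- the bijection is the canonical one
      (∀ (P : RMaxPoint structureSheaf) (α : Adele),
        Θ (Quotient.mk _ P) = adeleClass α ↔ IsAttached P α) ∧
      -- the Frobenius `Fr_t` corresponds to the idele class of `(t, 1)`
      (∀ (t : {t : ℝ // 0 < t}) (x : RMaxPoints structureSheaf),
        Θ (x.frob t) = (QuotientGroup.mk (posReal t) : IdeleClass) • Θ x) ∧
      -- every idele class comes from `Ẑˣ × ℝ₊ˣ` and acts as a Frobenius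
      (∀ c : IdeleClass, ∃ (u : zHatˣ) (t : {t : ℝ // 0 < t}),
        c = QuotientGroup.mk (zHatUnits u * posReal t) ∧
        ∀ x : RMaxPoints structureSheaf, c • Θ x = Θ (x.frob t)) ∧
      -- degenerate points: the finite adelic part, and the fixed points of the Frobenius
      (∀ P : RMaxPoint structureSheaf,
        (P.IsDegenerate ↔ ∃ a : FinAdele, Θ (Quotient.mk _ P) = adeleClass (Adele.mk 0 a)) ∧
        (P.IsDegenerate ↔ ∀ t : {t : ℝ // 0 < t},
          RMaxPoints.frob t (Quotient.mk _ P) = Quotient.mk _ P)) ∧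
      -- the subgroup of `ℝ` determined by a point
      (∀ (P : RMaxPoint structureSheaf) (α : Adele), Θ (Quotient.mk _ P) = adeleClass α →
        P.logRange = {y : ℝ | ∃ q ∈ subgroupOf α.fin, y = |α.real| * (q : ℝ)}) := by
  refine ⟨pointsEquiv, fun P α => pointsEquiv_mk_eq_iff, fun t x => ?_, fun c => ?_,
    fun P => ⟨isDegenerate_iff_exists_pointsEquiv_eq, isDegenerate_iff_forall_frob_mk_eq⟩,
    fun P α h => (pointsEquiv_mk_eq_iff.1 h).logRange_eq⟩
  · have h := pointsEquiv_frob 1 t x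
    rwa [map_one, one_mul] at h
  · obtain ⟨u, t, rfl⟩ := exists_ideleClass_eq_mk c
    exact ⟨u, t, rfl, fun x => (pointsEquiv_frob u t x).symm⟩
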